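/- Let $L>0$, let $a,b,c>0$ be constants and let $p\in L^1[0,L]$. Here $W^{4,1}[0,L]$ is the space of functions $y\in C^3[0,L]$ with $y'''$ absolutely continuous, and equations and inequalities involving $p$ or fourth derivatives are understood for almost every $x\in(0,L)$. Consider the Melan problem $$w''''(x)-\Bigl(a+b\int_0^L w\Bigr)w''(x)+c\int_0^L w=p(x),\quad x\in(0,L),\qquad w(0)=w(L)=w''(0)=w''(L)=0, \tag{1}$$ whose solutions are sought in $W^{4,1}[0,L]$. A lower solution (upper solution) of (1) is a function in $W^{4,1}[0,L]$ that satisfies the boundary conditions and the differential equation with "$=$" replaced by "$\le$" ("$\ge$"). Let $M,N>0$ be constants with $$N\le\frac{4M}{L^3}\,\sigma(\sqrt M L),\qquad \sigma(k):=\frac{3k^3}{6k\cosh k+6k-12\sinh k-k^3}.$$ Let $\alpha$ be a lower solution and $\beta$ an upper solution of (1) with $$0\le\alpha(x)\le\beta(x),\qquad 0\ge\alpha''(x)\ge\beta''(x)\qquad(x\in[0,L]),$$ $$a+b\int_0^L\beta\le M,\qquad c-b\min_{x\in[0,L]}\beta''(x)\le N,$$ and assume moreover that $$a+b\int_0^L\alpha+\frac{L^3}{4}c>\frac{L^3N}{4}+M-\frac{4}{L^2}.$$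 Put $[\alpha,\beta]:=\{u\in C^2[0,L]:\ \alpha\le u\le\beta,\ \alpha''\ge u''\ge\beta''\text{ on }[0,L]\}$. For $y_0\in[\alpha,\beta]$ consider the iteration, for $n=1,2,\dots$, with $y_n\in W^{4,1}[0,L]$, $$y_n''''-My_n''+N\int_0^L y_n=p+ay_{n-1}''+b\,y_{n-1}''\int_0^L y_{n-1}-c\int_0^L y_{n-1}-My_{n-1}''+N\int_0^L y_{n-1}, \tag{2}$$ $$y_n(0)=y_n(L)=y_n''(0)=y_n''(L)=0.$$ Then for every $y_0\in[\alpha,\beta]$ the iteration (2) determines a unique sequence $(y_n)$. The sequences $(\alpha_n)$ and $(\beta_n)$ obtained from $y_0=\alpha$ and $y_0=\beta$ are monotone: for all $n\ge 0$, on $[0,L]$, $$\alpha_n\le\alpha_{n+1},\quad \alpha_n\le\beta_n,\quad \beta_{n+1}\le\beta_n,\qquad \alpha_n''\ge\alpha_{n+1}'',\quad \alpha_n''\ge\beta_n'',\quad \beta_{n+1}''\ge\beta_n''.$$ Problem (1) has exactly one solution $\tilde y$ in $[\alpha,\beta]$; both $(\alpha_n)$ and $(\beta_n)$ converge uniformly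 on $[0,L]$ to $\tilde y$, and for every $y_0\in[\alpha,\beta]$ the sequence $(y_n)$ converges uniformly on $[0,L]$ to $\tilde y$. -/

import Mathlib

open Set MeasureTheory Filter Topology

noncomputable section

namespace Melan

/-- The `k`-th derivative on `[0, L]` (one-sided at the endpoints) of a function regarded as a
function on `[0, L]`; it depends only on the values of the function on `[0, L]`. -/
def D (L : ℝ) (k : ℕ) (y : ℝ → ℝ) : ℝ → ℝ :=
  iteratedDerivWithin k y (Icc 0 L)

/-- The Sobolev space `W^{4,1}[0, L]` (continuous representatives): the functions of class `C³`
on `[0, L]` whose third derivative is absolutely continuous. The fourth derivative `D L 4 y` then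
exists almost everywhere and is integrable. -/
def MemW41 (L : ℝ) (y : ℝ → ℝ) : Prop :=
  ContDiffOn ℝ 3 y (Icc 0 L) ∧ AbsolutelyContinuousOnInterval (D L 3 y) 0 L

/-- The Navier boundary conditions `y(0) = y(L) = y''(0) = y''(L) = 0`. -/
def NavierBC (L : ℝ) (y : ℝ → ℝ) : Prop :=
  y 0 = 0 ∧ y L = 0 ∧ D L 2 y 0 = 0 ∧ D L 2 y L = 0

/-- The left-hand side `y'''' - (a + b ∫ y) y'' + c ∫ y` of the Melan equation. -/
def melanOp (L a b c : ℝ) (y : ℝ → ℝ) (x : ℝ) : ℝ :=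
  D L 4 y x - (a + b * ∫ t in (0 : ℝ)..L, y t) * D L 2 y x + c * ∫ t in (0 : ℝ)..L, y t

/-- Solutions in `W^{4,1}[0, L]` of the Melan boundary value problem. -/
def IsSolution (L a b c : ℝ) (p y : ℝ → ℝ) : Prop :=
  MemW41 L y ∧ NavierBC L y ∧ ∀ᵐ x, x ∈ Ioo 0 L → melanOp L a b c y x = p x

def IsLowerSolution (L a b c : ℝ) (p α : ℝ → ℝ) : Prop :=
  MemW41 L α ∧ NavierBC L α ∧ ∀ᵐ x, x ∈ Ioo 0 L → melanOp L a b c α x ≤ p x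

def IsUpperSolution (L a b c : ℝ) (p β : ℝ → ℝ) : Prop :=
  MemW41 L β ∧ NavierBC L β ∧ ∀ᵐ x, x ∈ Ioo 0 L → p x ≤ melanOp L a b c β x

def sigma (k : ℝ) : ℝ :=
  3 * k ^ 3 / (6 * k * Real.cosh k + 6 * k - 12 * Real.sinh k - k ^ 3)

/-- The set `[α, β]` of all `u ∈ C²[0, L]` with `α ≤ u ≤ β` and `α'' ≥ u'' ≥ β''` on `[0, L]`. -/
def orderInterval (L : ℝ) (α β : ℝ → ℝ) : Set (ℝ → ℝ) :=
  {u | ContDiffOn ℝ 2 u (Icc 0 L) ∧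
    ∀ x ∈ Icc 0 L, (α x ≤ u x ∧ u x ≤ β x) ∧ (D L 2 β x ≤ D L 2 u x ∧ D L 2 u x ≤ D L 2 α x)}

/-- The linear operator `G y = y'''' - M y'' + N ∫ y`. -/
def linOp (L M N : ℝ) (y : ℝ → ℝ) (x : ℝ) : ℝ :=
  D L 4 y x - M * D L 2 y x + N * ∫ t in (0 : ℝ)..L, y t

/-- The nonlinearity `f(x, ∫ y, y'') = p + a y'' + b y'' ∫ y - c ∫ y`. -/
def nonlin (L a b c : ℝ) (p y : ℝ → ℝ) (x : ℝ) : ℝ :=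
  p x + a * D L 2 y x + b * D L 2 y x * (∫ t in (0 : ℝ)..L, y t) - c * ∫ t in (0 : ℝ)..L, y t

/-- `z` is obtained from `y` by one step of the iterative procedure:
`G z = f(x, ∫ y, y'') - M y'' + N ∫ y`, with `z` in the domain of `G`. -/
def IsStep (L a b c M N : ℝ) (p y z : ℝ → ℝ) : Prop :=
  MemW41 L z ∧ NavierBC L z ∧ ∀ᵐ x, x ∈ Ioo 0 L →
    linOp L M N z x =
      nonlin L a b c p y x - M * D L 2 y x + N * ∫ t in (0 : ℝ)..L, y t

/-- `y` is a sequence produced by the iterative procedure with the initial function `y₀`. -/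
def IsIteration (L a b c M N : ℝ) (p y₀ : ℝ → ℝ) (y : ℕ → ℝ → ℝ) : Prop :=
  y 0 = y₀ ∧ ∀ n, IsStep L a b c M N p (y n) (y (n + 1))

end Melan

end

/-
Since `u = -y''` satisfies `∫ y = ∫ x (L - x) / 2 * u`, the operator `y ↦ y'''' - M y'' + N ∫ y`
under Navier conditions is the second-order operator `u ↦ -u'' + M u + N ∫ x (L - x) / 2 * u` under
Dirichlet conditions. This rank-one perturbation of a positive operator stays inverse positive as
long as `N` times the product of the responses to the two loads defining the perturbation is
dominated by Green's function, and `sigma` is the constant in that kernel inequality. As a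
consequence the iteration is monotone on `[α, β]` for the order `y ≤ z`, `z'' ≤ y''`, so it traps
every orbit between the orbits of `α` and `β`. Dropping the nonnegative zero-order terms in the
equation for the difference of two orbits bounds its fourth derivative from one side, hence its
second derivative shrinks by a fixed factor at each step, and the nested order intervals close
up to a single point.
-/

namespace Melan

/-! ### Functions of class `W^{2,1}` -/

theorem ae_restrict_Icc_iff {s t : ℝ} {P : ℝ → Prop} :
    (∀ᵐ x ∂volume.restrict (Icc s t), P x) ↔ ∀ᵐ x, x ∈ Ioo s t → P x := by
  rw [← restrict_Ioo_eq_restrict_Icc, ae_restrict_iff' measurableSet_Ioo]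

theorem absolutelyContinuous_of_hasDerivWithinAt {f f' : ℝ → ℝ} {s t : ℝ} (hst : s ≤ t)
    (hf : ∀ x ∈ Icc s t, HasDerivWithinAt f (f' x) (Icc s t) x)
    (hf' : ContinuousOn f' (Icc s t)) : AbsolutelyContinuousOnInterval f s t := by
  obtain ⟨K, hK⟩ := isCompact_Icc.exists_bound_of_continuousOn hf'
  have hbound : ∀ x ∈ Icc s t, ‖f' x‖₊ ≤ K.toNNReal := fun x hx => by
    rw [← NNReal.coe_le_coe, coe_nnnorm]
    exact (hK x hx).trans (Real.le_coe_toNNReal K)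
  have hlip := (convex_Icc s t).lipschitzOnWith_of_nnnorm_hasDerivWithin_le hf hbound
  rw [← uIcc_of_le hst] at hlip
  exact hlip.absolutelyContinuousOnInterval

theorem absolutelyContinuous_congr {f g : ℝ → ℝ} {s t : ℝ}
    (hf : AbsolutelyContinuousOnInterval f s t) (h : EqOn f g (uIcc s t)) :
    AbsolutelyContinuousOnInterval g s t := by
  rw [absolutelyContinuousOnInterval_iff] at hf ⊢
  intro ε hε
  obtain ⟨δ, hδ, hsmall⟩ := hf ε hε
  refine ⟨δ, hδ, fun E hE hs => ?_⟩
  have hsum : ∑ i ∈ Finset.range E.1, dist (g (E.2 i).1) (g (E.2 i).2) =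
      ∑ i ∈ Finset.range E.1, dist (f (E.2 i).1) (f (E.2 i).2) :=
    Finset.sum_congr rfl fun i hi => by rw [h (hE.1 i hi).1, h (hE.1 i hi).2]
  exact hsum ▸ hsmall E hE hs

section AbsolutelyContinuous

variable {f f' : ℝ → ℝ} {s t : ℝ}

theorem ae_deriv_eq (hf' : ∀ᵐ x, x ∈ Ioo s t → HasDerivAt f (f' x) x) :
    deriv f =ᵐ[volume.restrict (Icc s t)] f' := by
  filter_upwards [ae_restrict_Icc_iff.2 hf'] with x hx using hx.deriv

theorem intervalIntegrable_of_ae_hasDerivAt (hst : s ≤ t)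
    (hf : AbsolutelyContinuousOnInterval f s t)
    (hf' : ∀ᵐ x, x ∈ Ioo s t → HasDerivAt f (f' x) x) : IntervalIntegrable f' volume s t := by
  refine hf.intervalIntegrable_deriv.congr_ae ?_
  rw [uIoc_of_le hst, restrict_Ioc_eq_restrict_Icc]
  exact ae_deriv_eq hf'

theorem integral_eq_sub_of_ae_hasDerivAt (hst : s ≤ t) (hf : AbsolutelyContinuousOnInterval f s t)
    (hf' : ∀ᵐ x, x ∈ Ioo s t → HasDerivAt f (f' x) x) : ∫ x in s..t, f' x = f t - f s := by
  rw [← hf.integral_deriv_eq_sub]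
  exact (intervalIntegral.integral_congr_ae_restrict <| by
    rw [uIoc_of_le hst, restrict_Ioc_eq_restrict_Icc]; exact ae_deriv_eq hf').symm

theorem integral_eq_sub_of_ae_hasDerivAt_of_mem (hf : AbsolutelyContinuousOnInterval f s t)
    (hf' : ∀ᵐ x, x ∈ Ioo s t → HasDerivAt f (f' x) x) {x y : ℝ} (hx : x ∈ Icc s t)
    (hy : y ∈ Icc s t) (hxy : x ≤ y) : ∫ z in x..y, f' z = f y - f x := by
  refine integral_eq_sub_of_ae_hasDerivAt hxy (hf.mono ?_) (hf'.mono fun z hz hzI => hz ?_)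
  · rw [uIcc_of_le hxy, uIcc_of_le (hx.1.trans hx.2)]
    exact Icc_subset_Icc hx.1 hy.2
  · exact Ioo_subset_Ioo hx.1 hy.2 hzI

theorem antitoneOn_of_ae_hasDerivAt_nonpos (hf : AbsolutelyContinuousOnInterval f s t)
    (hf' : ∀ᵐ x, x ∈ Ioo s t → HasDerivAt f (f' x) x) (h : ∀ᵐ x, x ∈ Ioo s t → f' x ≤ 0) :
    AntitoneOn f (Icc s t) := by
  intro x hx y hy hxy
  have hneg : 0 ≤ ∫ z in x..y, -f' z := by
    refine intervalIntegral.integral_nonneg_of_ae_restrict hxy (ae_restrict_Icc_iff.2 ?_)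
    filter_upwards [h] with z hz hzI
    exact neg_nonneg.2 (hz (Ioo_subset_Ioo hx.1 hy.2 hzI))
  rw [intervalIntegral.integral_neg,
    integral_eq_sub_of_ae_hasDerivAt_of_mem hf hf' hx hy hxy] at hneg
  linarith

theorem hasDerivWithinAt_of_ae_hasDerivAt (hf : AbsolutelyContinuousOnInterval f s t)
    (hf' : ∀ᵐ x, x ∈ Ioo s t → HasDerivAt f (f' x) x) (hcont : ContinuousOn f' (Icc s t)) :
    ∀ x ∈ Icc s t, HasDerivWithinAt f (f' x) (Icc s t) x := by
  intro x hx
  have hs : s ∈ Icc s t := left_mem_Icc.2 (hx.1.trans hx.2)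
  have hint : IntervalIntegrable f' volume s x := by
    refine (hcont.mono ?_).intervalIntegrable
    rw [uIcc_of_le hx.1]
    exact Icc_subset_Icc_right hx.2
  have : Fact (x ∈ Icc s t) := ⟨hx⟩
  have hder : HasDerivWithinAt (fun y => ∫ z in s..y, f' z) (f' x) (Icc s t) x :=
    intervalIntegral.integral_hasDerivWithinAt_right hint
      (hcont.stronglyMeasurableAtFilter_nhdsWithin measurableSet_Icc x) (hcont x hx)
  have heq : ∀ y ∈ Icc s t, f y = (∫ z in s..y, f' z) + f s := fun y hy => by
    rw [integral_eq_sub_of_ae_hasDerivAt_of_mem hf hf' hs hy hy.1]; ring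
  exact (hder.add_const (f s)).congr heq (heq x hx)

theorem absolutelyContinuous_primitive (hf : IntervalIntegrable f volume s t) :
    AbsolutelyContinuousOnInterval (fun x => ∫ z in s..x, f z) s t :=
  hf.absolutelyContinuousOnInterval_intervalIntegral left_mem_uIcc

theorem ae_hasDerivAt_primitive (hf : IntervalIntegrable f volume s t) :
    ∀ᵐ x, x ∈ Ioo s t → HasDerivAt (fun y => ∫ z in s..y, f z) (f x) x := by
  filter_upwards [hf.ae_hasDerivAt_integral] with x hx hxI
  exact hx (Icc_subset_uIcc (Ioo_subset_Icc_self hxI)) s left_mem_uIcc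

end AbsolutelyContinuous

/-- A function `u` of class `W^{2,1}` on `[s, t]` together with its derivative `u₁`, which is
absolutely continuous, and a version `u₂` of its second derivative. Carrying the derivatives
explicitly avoids working with `deriv` of a function known only on `[s, t]`. -/
structure W21Jet (s t : ℝ) (u u₁ u₂ : ℝ → ℝ) : Prop where
  deriv : ∀ x ∈ Icc s t, HasDerivWithinAt u (u₁ x) (Icc s t) x
  ac : AbsolutelyContinuousOnInterval u₁ s t
  ae_deriv : ∀ᵐ x, x ∈ Ioo s t → HasDerivAt u₁ (u₂ x) x

namespace W21Jet

variable {s t : ℝ} {u u₁ u₂ v v₁ v₂ : ℝ → ℝ}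

theorem mono (hu : W21Jet s t u u₁ u₂) {s' t' : ℝ} (hs : s ≤ s') (hst : s' ≤ t') (ht : t' ≤ t) :
    W21Jet s' t' u u₁ u₂ where
  deriv x hx := (hu.deriv x (Icc_subset_Icc hs ht hx)).mono (Icc_subset_Icc hs ht)
  ac := hu.ac.mono <| by
    rw [uIcc_of_le hst, uIcc_of_le (hs.trans (hst.trans ht))]
    exact Icc_subset_Icc hs ht
  ae_deriv := hu.ae_deriv.mono fun _ hx hxI => hx (Ioo_subset_Ioo hs ht hxI)

theorem of_hasDerivWithinAt (hst : s ≤ t)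
    (h₁ : ∀ x ∈ Icc s t, HasDerivWithinAt u (u₁ x) (Icc s t) x)
    (h₂ : ∀ x ∈ Icc s t, HasDerivWithinAt u₁ (u₂ x) (Icc s t) x)
    (hcont : ContinuousOn u₂ (Icc s t)) : W21Jet s t u u₁ u₂ where
  deriv := h₁
  ac := absolutelyContinuous_of_hasDerivWithinAt hst h₂ hcont
  ae_deriv := .of_forall fun x hx =>
    (h₂ x (Ioo_subset_Icc_self hx)).hasDerivAt (Icc_mem_nhds hx.1 hx.2)

theorem of_hasDerivAt (hst : s ≤ t) (h₁ : ∀ x, HasDerivAt u (u₁ x) x)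
    (h₂ : ∀ x, HasDerivAt u₁ (u₂ x) x) (hcont : Continuous u₂) : W21Jet s t u u₁ u₂ :=
  of_hasDerivWithinAt hst (fun x _ => (h₁ x).hasDerivWithinAt)
    (fun x _ => (h₂ x).hasDerivWithinAt) hcont.continuousOn

theorem sub (hu : W21Jet s t u u₁ u₂) (hv : W21Jet s t v v₁ v₂) :
    W21Jet s t (fun x => u x - v x) (fun x => u₁ x - v₁ x) (fun x => u₂ x - v₂ x) where
  deriv x hx := (hu.deriv x hx).sub (hv.deriv x hx)
  ac := hu.ac.sub hv.ac
  ae_deriv := by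
    filter_upwards [hu.ae_deriv, hv.ae_deriv] with x hux hvx hx using (hux hx).sub (hvx hx)

theorem const_mul (hu : W21Jet s t u u₁ u₂) (r : ℝ) :
    W21Jet s t (fun x => r * u x) (fun x => r * u₁ x) (fun x => r * u₂ x) where
  deriv x hx := (hu.deriv x hx).const_mul r
  ac := hu.ac.const_mul r
  ae_deriv := by filter_upwards [hu.ae_deriv] with x hux hx using (hux hx).const_mul r

theorem congr_ae (hu : W21Jet s t u u₁ u₂) (h : ∀ᵐ x, x ∈ Ioo s t → u₂ x = v₂ x) :
    W21Jet s t u u₁ v₂ where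
  deriv := hu.deriv
  ac := hu.ac
  ae_deriv := by filter_upwards [hu.ae_deriv, h] with x hux h hx using h hx ▸ hux hx

theorem continuousOn (hu : W21Jet s t u u₁ u₂) : ContinuousOn u (Icc s t) :=
  fun x hx => (hu.deriv x hx).continuousWithinAt

theorem continuousOn_uIcc (hst : s ≤ t) (hu : W21Jet s t u u₁ u₂) : ContinuousOn u (uIcc s t) :=
  (uIcc_of_le hst).symm ▸ hu.continuousOn

theorem intervalIntegrable (hst : s ≤ t) (hu : W21Jet s t u u₁ u₂) :
    IntervalIntegrable u volume s t :=
  (hu.continuousOn_uIcc hst).intervalIntegrable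

theorem intervalIntegrable_deriv₂ (hst : s ≤ t) (hu : W21Jet s t u u₁ u₂) :
    IntervalIntegrable u₂ volume s t :=
  intervalIntegrable_of_ae_hasDerivAt hst hu.ac hu.ae_deriv

theorem absolutelyContinuous (hst : s ≤ t) (hu : W21Jet s t u u₁ u₂) :
    AbsolutelyContinuousOnInterval u s t :=
  absolutelyContinuous_of_hasDerivWithinAt hst hu.deriv
    (uIcc_of_le hst ▸ hu.ac.continuousOn)

theorem integral_wronskian (hst : s ≤ t) (hu : W21Jet s t u u₁ u₂) (hv : W21Jet s t v v₁ v₂) :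
    ∫ x in s..t, (u x * v₂ x - u₂ x * v x) =
      (u t * v₁ t - u₁ t * v t) - (u s * v₁ s - u₁ s * v s) := by
  have hac : AbsolutelyContinuousOnInterval (fun x => u x * v₁ x - u₁ x * v x) s t :=
    ((hu.absolutelyContinuous hst).mul hv.ac).sub (hu.ac.mul (hv.absolutelyContinuous hst))
  refine integral_eq_sub_of_ae_hasDerivAt hst hac ?_
  filter_upwards [hu.ae_deriv, hv.ae_deriv] with x hu₂ hv₂ hx
  have hnhds := Icc_mem_nhds hx.1 hx.2
  have hu₁ := (hu.deriv x (Ioo_subset_Icc_self hx)).hasDerivAt hnhds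
  have hv₁ := (hv.deriv x (Ioo_subset_Icc_self hx)).hasDerivAt hnhds
  exact ((hu₁.mul (hv₂ hx)).sub ((hu₂ hx).mul hv₁)).congr_deriv (by ring)

end W21Jet

/-- A `W21Jet` on `[0, L]` with homogeneous Dirichlet boundary conditions. -/
structure DirichletJet (L : ℝ) (u u₁ u₂ : ℝ → ℝ) : Prop extends W21Jet 0 L u u₁ u₂ where
  left : u 0 = 0
  right : u L = 0

/-- The solution of `-u'' = 1`, `u 0 = u L = 0`; being the response to a unit load, it represents
the functional `u ↦ ∫ u` in terms of `u''`. -/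
noncomputable def parabola (L x : ℝ) : ℝ := x * (L - x) / 2

theorem parabola_nonneg {L x : ℝ} (hx : x ∈ Icc 0 L) : 0 ≤ parabola L x :=
  div_nonneg (mul_nonneg hx.1 (sub_nonneg.2 hx.2)) zero_le_two

theorem parabola_le (L x : ℝ) : parabola L x ≤ L ^ 2 / 8 := by
  rw [parabola]; nlinarith [sq_nonneg (x - L / 2)]

theorem dirichletJet_parabola {L : ℝ} (hL : 0 ≤ L) :
    DirichletJet L (parabola L) (fun x => L / 2 - x) (fun _ => -1) where
  toW21Jet := .of_hasDerivAt hL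
    (fun x => (((hasDerivAt_id x).mul ((hasDerivAt_id x).const_sub L)).div_const 2).congr_deriv
      (by simp only [id_eq]; ring))
    (fun x => (hasDerivAt_id x).const_sub (L / 2)) continuous_const
  left := by simp [parabola]
  right := by simp [parabola]

namespace DirichletJet

variable {L : ℝ} {u u₁ u₂ v v₁ v₂ : ℝ → ℝ}

theorem sub (hu : DirichletJet L u u₁ u₂) (hv : DirichletJet L v v₁ v₂) :
    DirichletJet L (fun x => u x - v x) (fun x => u₁ x - v₁ x) (fun x => u₂ x - v₂ x) where
  toW21Jet := hu.toW21Jet.sub hv.toW21Jet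
  left := by rw [hu.left, hv.left, sub_zero]
  right := by rw [hu.right, hv.right, sub_zero]

theorem const_mul (hu : DirichletJet L u u₁ u₂) (r : ℝ) :
    DirichletJet L (fun x => r * u x) (fun x => r * u₁ x) (fun x => r * u₂ x) where
  toW21Jet := hu.toW21Jet.const_mul r
  left := by rw [hu.left, mul_zero]
  right := by rw [hu.right, mul_zero]

theorem integral_mul_comm (hL : 0 ≤ L) (hu : DirichletJet L u u₁ u₂)
    (hv : DirichletJet L v v₁ v₂) :
    ∫ x in 0..L, u x * v₂ x = ∫ x in 0..L, u₂ x * v x := by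
  have hw := hu.toW21Jet.integral_wronskian hL hv.toW21Jet
  rw [hu.left, hu.right, hv.left, hv.right, intervalIntegral.integral_sub
    ((hv.intervalIntegrable_deriv₂ hL).continuousOn_mul (hu.continuousOn_uIcc hL))
    ((hu.intervalIntegrable_deriv₂ hL).mul_continuousOn (hv.continuousOn_uIcc hL))] at hw
  linarith

theorem integral_eq_neg_integral_parabola_mul (hL : 0 ≤ L) (hu : DirichletJet L u u₁ u₂) :
    ∫ x in 0..L, u x = -∫ x in 0..L, parabola L x * u₂ x := by
  rw [(dirichletJet_parabola hL).integral_mul_comm hL hu, ← intervalIntegral.integral_neg]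
  simp only [neg_mul, one_mul, neg_neg]

theorem nonneg (hu : DirichletJet L u u₁ u₂) (h : ∀ᵐ x, x ∈ Ioo 0 L → u₂ x ≤ 0) :
    ∀ x ∈ Icc 0 L, 0 ≤ u x := by
  intro x hx
  have hL : 0 ≤ L := hx.1.trans hx.2
  have hanti := antitoneOn_of_ae_hasDerivAt_nonpos hu.ac hu.ae_deriv h
  have hder : ∀ y ∈ interior (Icc 0 L), HasDerivAt u (u₁ y) y := fun y hy =>
    (hu.deriv y (interior_subset hy)).hasDerivAt (mem_interior_iff_mem_nhds.1 hy)
  have hconc : ConcaveOn ℝ (Icc 0 L) u :=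
    AntitoneOn.concaveOn_of_deriv (convex_Icc 0 L) hu.continuousOn
      (fun y hy => (hder y hy).differentiableAt.differentiableWithinAt)
      ((hanti.mono interior_subset).congr fun y hy => (hder y hy).deriv.symm)
  simpa only [hu.left, hu.right, min_self] using
    hconc.min_le_of_mem_Icc (left_mem_Icc.2 hL) (right_mem_Icc.2 hL) hx

theorem le_mul_sq {R : ℝ} (hu : DirichletJet L u u₁ u₂) (hR : 0 ≤ R)
    (h : ∀ᵐ x, x ∈ Ioo 0 L → -R ≤ u₂ x) : ∀ x ∈ Icc 0 L, u x ≤ R * (L ^ 2 / 8) := by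
  intro x hx
  have hdiff := (((dirichletJet_parabola (hx.1.trans hx.2)).const_mul R).sub hu).nonneg
    (h.mono fun y hy hyI => by linarith [hy hyI]) x hx
  have := mul_le_mul_of_nonneg_left (parabola_le L x) hR
  linarith

theorem integral_mul_sub_comm (hL : 0 ≤ L) (hu : DirichletJet L u u₁ u₂)
    (hv : DirichletJet L v v₁ v₂) (r : ℝ) :
    ∫ x in 0..L, u x * (r * v x - v₂ x) = ∫ x in 0..L, (r * u x - u₂ x) * v x := by
  have hr : IntervalIntegrable (fun x => r * (u x * v x)) volume 0 L :=
    (((hu.continuousOn_uIcc hL).mul (hv.continuousOn_uIcc hL)).const_mul r).intervalIntegrable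
  simp only [mul_sub, sub_mul, mul_left_comm _ r, mul_assoc r]
  rw [intervalIntegral.integral_sub hr
      ((hv.intervalIntegrable_deriv₂ hL).continuousOn_mul (hu.continuousOn_uIcc hL)),
    intervalIntegral.integral_sub hr
      ((hu.intervalIntegrable_deriv₂ hL).mul_continuousOn (hv.continuousOn_uIcc hL)),
    hu.integral_mul_comm hL hv]

end DirichletJet

/-! ### The kernel of the maximum principle -/

theorem sinh_lt_mul_cosh {z : ℝ} (hz : 0 < z) : Real.sinh z < z * Real.cosh z := by
  have hmono : StrictMonoOn (fun w => w * Real.cosh w - Real.sinh w) (Ici 0) := by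
    refine strictMonoOn_of_deriv_pos (convex_Ici 0) (by fun_prop) fun x hx => ?_
    rw [interior_Ici] at hx
    have hder : HasDerivAt (fun w => w * Real.cosh w - Real.sinh w) (x * Real.sinh x) x :=
      (((hasDerivAt_id x).mul (Real.hasDerivAt_cosh x)).sub (Real.hasDerivAt_sinh x)).congr_deriv
        (by simp only [id_eq]; ring)
    rw [hder.deriv]
    exact mul_pos hx (Real.sinh_pos_iff.2 hx)
  simpa only [Real.sinh_zero, zero_mul, sub_zero, sub_pos] using
    hmono (mem_Ici.2 le_rfl) (mem_Ici.2 hz.le) hz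

theorem cosh_sub_one_le {z : ℝ} (hz : 0 ≤ z) : Real.cosh z - 1 ≤ z / 2 * Real.sinh z := by
  rcases hz.eq_or_lt with rfl | hz
  · simp
  have hhalf := mul_lt_mul_of_pos_left (sinh_lt_mul_cosh (half_pos hz))
    (Real.sinh_pos_iff.2 (half_pos hz))
  have hcosh : Real.cosh z = 2 * Real.sinh (z / 2) ^ 2 + 1 := by
    conv_lhs => rw [← mul_div_cancel₀ z two_ne_zero, Real.cosh_two_mul, Real.cosh_sq]
    ring
  have hsinh : Real.sinh z = 2 * Real.sinh (z / 2) * Real.cosh (z / 2) := by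
    conv_lhs => rw [← mul_div_cancel₀ z two_ne_zero, Real.sinh_two_mul]
  rw [hcosh, hsinh]
  linarith

theorem sinh_add_sinh_le {x y : ℝ} (hx : 0 ≤ x) (hy : 0 ≤ y) :
    Real.sinh x + Real.sinh y ≤ Real.sinh (x + y) := by
  rw [Real.sinh_add]
  nlinarith [Real.one_le_cosh x, Real.one_le_cosh y, Real.sinh_nonneg_iff.2 hx,
    Real.sinh_nonneg_iff.2 hy]

section Hyperbolic

variable {k L x : ℝ}

theorem hasDerivAt_sinh_mul (k x : ℝ) :
    HasDerivAt (fun x => Real.sinh (k * x)) (k * Real.cosh (k * x)) x :=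
  ((Real.hasDerivAt_sinh (k * x)).comp x ((hasDerivAt_id x).const_mul k)).congr_deriv (by ring)

theorem hasDerivAt_cosh_mul (k x : ℝ) :
    HasDerivAt (fun x => Real.cosh (k * x)) (k * Real.sinh (k * x)) x :=
  ((Real.hasDerivAt_cosh (k * x)).comp x ((hasDerivAt_id x).const_mul k)).congr_deriv (by ring)

theorem w21Jet_sinh_mul {s t : ℝ} (hst : s ≤ t) (k : ℝ) :
    W21Jet s t (fun x => Real.sinh (k * x)) (fun x => k * Real.cosh (k * x))
      (fun x => k ^ 2 * Real.sinh (k * x)) :=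
  .of_hasDerivAt hst (hasDerivAt_sinh_mul k)
    (fun x => ((hasDerivAt_cosh_mul k x).const_mul k).congr_deriv (by ring)) (by fun_prop)

theorem hasDerivAt_cosh_mul_sub (k L x : ℝ) :
    HasDerivAt (fun x => Real.cosh (k * (L - x))) (-(k * Real.sinh (k * (L - x)))) x :=
  ((hasDerivAt_cosh_mul k (L - x)).comp x ((hasDerivAt_id x).const_sub L)).congr_deriv (by ring)

theorem w21Jet_sinh_mul_sub {s t : ℝ} (hst : s ≤ t) (k L : ℝ) :
    W21Jet s t (fun x => Real.sinh (k * (L - x))) (fun x => -(k * Real.cosh (k * (L - x))))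
      (fun x => k ^ 2 * Real.sinh (k * (L - x))) :=
  .of_hasDerivAt hst
    (fun x => ((hasDerivAt_sinh_mul k (L - x)).comp x ((hasDerivAt_id x).const_sub L)).congr_deriv
      (by ring))
    (fun x => ((hasDerivAt_cosh_mul_sub k L x).const_mul k).neg.congr_deriv (by ring))
    (by fun_prop)

/-- The solution of `-T'' + k² T = k² sinh (k L)`, `T 0 = T L = 0`. -/
noncomputable def constResponse (k L x : ℝ) : ℝ :=
  Real.sinh (k * L) - Real.sinh (k * (L - x)) - Real.sinh (k * x)

/-- The solution of `-Φ'' + k² Φ = k⁴ sinh (k L) φ`, `Φ 0 = Φ L = 0`, where `φ` is `parabola L`. -/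
noncomputable def parabolaResponse (k L x : ℝ) : ℝ :=
  k ^ 2 * Real.sinh (k * L) * parabola L x - constResponse k L x

theorem dirichletJet_constResponse (hL : 0 ≤ L) (k : ℝ) :
    DirichletJet L (constResponse k L)
      (fun x => k * Real.cosh (k * (L - x)) - k * Real.cosh (k * x))
      (fun x => k ^ 2 * (constResponse k L x - Real.sinh (k * L))) where
  toW21Jet := .of_hasDerivAt hL
    (fun x => ((((hasDerivAt_sinh_mul k (L - x)).comp x
      ((hasDerivAt_id x).const_sub L)).const_sub _).sub (hasDerivAt_sinh_mul k x)).congr_deriv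
        (by ring))
    (fun x => (((hasDerivAt_cosh_mul_sub k L x).const_mul k).sub
      ((hasDerivAt_cosh_mul k x).const_mul k)).congr_deriv (by simp only [constResponse]; ring))
    (by unfold constResponse; fun_prop)
  left := by simp [constResponse]
  right := by simp [constResponse]

theorem dirichletJet_parabolaResponse (hL : 0 ≤ L) (k : ℝ) :
    DirichletJet L (parabolaResponse k L)
      (fun x => k ^ 2 * Real.sinh (k * L) * (L / 2 - x) -
        (k * Real.cosh (k * (L - x)) - k * Real.cosh (k * x)))
      (fun x => -(k ^ 2 * constResponse k L x)) := by
  have hjet := ((dirichletJet_parabola hL).const_mul (k ^ 2 * Real.sinh (k * L))).sub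
    (dirichletJet_constResponse hL k)
  exact ⟨hjet.toW21Jet.congr_ae (.of_forall fun x _ => by ring), hjet.left, hjet.right⟩

theorem constResponse_symm (k L x : ℝ) : constResponse k L (L - x) = constResponse k L x := by
  simp only [constResponse, sub_sub_cancel]; ring

theorem parabolaResponse_symm (k L x : ℝ) :
    parabolaResponse k L (L - x) = parabolaResponse k L x := by
  simp only [parabolaResponse, constResponse_symm, parabola]; ring

theorem constResponse_nonneg (hk : 0 ≤ k) (hx : x ∈ Icc 0 L) : 0 ≤ constResponse k L x := by
  have hadd := sinh_add_sinh_le (mul_nonneg hk (sub_nonneg.2 hx.2)) (mul_nonneg hk hx.1)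
  rw [← mul_add, sub_add_cancel] at hadd
  rw [constResponse]
  linarith

theorem parabolaResponse_nonneg (hk : 0 ≤ k) (hx : x ∈ Icc 0 L) : 0 ≤ parabolaResponse k L x :=
  (dirichletJet_parabolaResponse (hx.1.trans hx.2) k).nonneg (.of_forall fun _ hy =>
    neg_nonpos.2 (mul_nonneg (sq_nonneg k)
      (constResponse_nonneg hk (Ioo_subset_Icc_self hy)))) x hx

theorem constResponse_eq (k L x : ℝ) : constResponse k L x =
    Real.sinh (k * L) * (1 - Real.cosh (k * x)) + (Real.cosh (k * L) - 1) * Real.sinh (k * x) := by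
  simp only [constResponse, mul_sub, Real.sinh_sub]; ring

theorem constResponse_le (hkL : 0 ≤ k * L) (x : ℝ) :
    constResponse k L x ≤ (Real.cosh (k * L) - 1) * Real.sinh (k * x) := by
  rw [constResponse_eq]
  nlinarith [Real.one_le_cosh (k * x), Real.sinh_nonneg_iff.2 hkL]

theorem parabolaResponse_le (hk : 0 ≤ k) (hx : x ∈ Icc 0 L) :
    parabolaResponse k L x ≤
      (k * L / 2 * Real.sinh (k * L) - (Real.cosh (k * L) - 1)) * Real.sinh (k * x) := by
  have hkx : 0 ≤ k * x := mul_nonneg hk hx.1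
  have hkxL : k * x ≤ k * L := mul_le_mul_of_nonneg_left hx.2 hk
  have hsinh : 0 ≤ Real.sinh (k * L) := Real.sinh_nonneg_iff.2 (hkx.trans hkxL)
  have hdefect : 0 ≤ k * L / 2 * (Real.sinh (k * x) - k * x) + (k * x) ^ 2 / 2 + 1
      - Real.cosh (k * x) := by
    nlinarith [cosh_sub_one_le hkx,
      mul_nonneg (sub_nonneg.2 hkxL) (sub_nonneg.2 (Real.self_le_sinh_iff.2 hkx))]
  rw [parabolaResponse, constResponse_eq, parabola]
  nlinarith [mul_nonneg hsinh hdefect]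

theorem integral_parabolaResponse (hk : k ≠ 0) :
    ∫ s in 0..L, parabolaResponse k L s =
      k ^ 2 * Real.sinh (k * L) * (L ^ 3 / 12) - L * Real.sinh (k * L)
        + 2 * (Real.cosh (k * L) - 1) / k := by
  have hder : ∀ s, HasDerivAt (fun s => k ^ 2 * Real.sinh (k * L) * (L * s ^ 2 / 4 - s ^ 3 / 6) -
      (Real.sinh (k * L) * s + Real.cosh (k * (L - s)) / k - Real.cosh (k * s) / k))
      (parabolaResponse k L s) s := fun s => by
    have hpoly := ((((hasDerivAt_pow 2 s).const_mul L).div_const 4).sub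
      ((hasDerivAt_pow 3 s).div_const 6)).const_mul (k ^ 2 * Real.sinh (k * L))
    have hcosh := (((hasDerivAt_id s).const_mul (Real.sinh (k * L))).add
      ((hasDerivAt_cosh_mul_sub k L s).div_const k)).sub ((hasDerivAt_cosh_mul k s).div_const k)
    refine (hpoly.sub hcosh).congr_deriv ?_
    simp only [parabolaResponse, constResponse, parabola]
    field_simp
    ring
  have hcont : Continuous (parabolaResponse k L) := by
    unfold parabolaResponse constResponse parabola; fun_prop
  rw [intervalIntegral.integral_eq_sub_of_hasDerivAt (fun s _ => hder s)
    (hcont.intervalIntegrable 0 L)]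
  simp only [sub_self, mul_zero, sub_zero, Real.cosh_zero]
  ring

/-- Up to the factor `k sinh (k L)`, the Green function of `-u'' + k² u` on `[0, L]` with Dirichlet
boundary conditions. -/
noncomputable def green (k L x s : ℝ) : ℝ :=
  Real.sinh (k * min x s) * Real.sinh (k * (L - max x s))

theorem continuous_green (k L x : ℝ) : Continuous (green k L x) := by
  unfold green; fun_prop

theorem green_symm (k L x s : ℝ) : green k L (L - x) (L - s) = green k L x s := by
  rw [green, green, min_sub_sub_left, max_sub_sub_left, sub_sub_cancel, mul_comm]

theorem green_nonneg (hk : 0 ≤ k) (hx : x ∈ Icc 0 L) {s : ℝ} (hs : s ∈ Icc 0 L) :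
    0 ≤ green k L x s :=
  mul_nonneg (Real.sinh_nonneg_iff.2 (mul_nonneg hk (le_min hx.1 hs.1)))
    (Real.sinh_nonneg_iff.2 (mul_nonneg hk (sub_nonneg.2 (max_le hx.2 hs.2))))

/-- The left-hand side is the kernel through which the nonlocal term acts. -/
theorem constResponse_mul_parabolaResponse_le (hk : 0 ≤ k) (hx : x ∈ Icc 0 L) {s : ℝ}
    (hs : s ∈ Icc 0 L) :
    constResponse k L x * parabolaResponse k L s ≤
      (Real.cosh (k * L) - 1) * (k * L / 2 * Real.sinh (k * L) - (Real.cosh (k * L) - 1)) *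
        green k L x s := by
  wlog hsx : s ≤ x generalizing x s
  · have hrefl : ∀ {z}, z ∈ Icc 0 L → L - z ∈ Icc 0 L := fun hz =>
      ⟨sub_nonneg.2 hz.2, sub_le_self L hz.1⟩
    have := this (hrefl hx) (hrefl hs) (by linarith)
    rwa [constResponse_symm, parabolaResponse_symm, green_symm] at this
  have hkL : 0 ≤ k * L := mul_nonneg hk (hx.1.trans hx.2)
  have hT := constResponse_le hkL (L - x)
  rw [constResponse_symm] at hT
  calc constResponse k L x * parabolaResponse k L s
      ≤ ((Real.cosh (k * L) - 1) * Real.sinh (k * (L - x))) *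
          ((k * L / 2 * Real.sinh (k * L) - (Real.cosh (k * L) - 1)) * Real.sinh (k * s)) :=
        mul_le_mul hT (parabolaResponse_le hk hs) (parabolaResponse_nonneg hk hs)
          ((constResponse_nonneg hk hx).trans hT)
    _ = _ := by rw [green, min_eq_right hsx, max_eq_left hsx]; ring

theorem integral_green_mul (hx : x ∈ Icc 0 L) {g : ℝ → ℝ} (hg : IntervalIntegrable g volume 0 L) :
    ∫ s in 0..L, green k L x s * g s =
      Real.sinh (k * (L - x)) * (∫ s in 0..x, Real.sinh (k * s) * g s) +
        Real.sinh (k * x) * ∫ s in x..L, Real.sinh (k * (L - s)) * g s := by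
  have hint : IntervalIntegrable (fun s => green k L x s * g s) volume 0 L :=
    hg.continuousOn_mul (continuous_green k L x).continuousOn
  have hxL : x ∈ uIcc 0 L := Icc_subset_uIcc hx
  rw [← intervalIntegral.integral_add_adjacent_intervals
      (hint.mono_set (uIcc_subset_uIcc left_mem_uIcc hxL))
      (hint.mono_set (uIcc_subset_uIcc hxL right_mem_uIcc)),
    ← intervalIntegral.integral_const_mul, ← intervalIntegral.integral_const_mul]
  congr 1 <;> refine intervalIntegral.integral_congr fun s hs => ?_
  · rw [uIcc_of_le hx.1] at hs
    simp only [green, min_eq_right hs.2, max_eq_left hs.2]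
    ring
  · rw [uIcc_of_le hx.2] at hs
    simp only [green, min_eq_left hs.1, max_eq_right hs.1]
    ring

theorem integral_green_mul_eq {u u₁ u₂ : ℝ → ℝ} (hu : DirichletJet L u u₁ u₂) (hx : x ∈ Icc 0 L) :
    ∫ s in 0..L, green k L x s * (k ^ 2 * u s - u₂ s) = k * Real.sinh (k * L) * u x := by
  have hL : 0 ≤ L := hx.1.trans hx.2
  have hleft := (hu.toW21Jet.mono le_rfl hx.1 hx.2).integral_wronskian hx.1 (w21Jet_sinh_mul hx.1 k)
  have hright := (hu.toW21Jet.mono hx.1 hx.2 le_rfl).integral_wronskian hx.2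
    (w21Jet_sinh_mul_sub hx.2 k L)
  have hswap : ∀ S s : ℝ, u s * (k ^ 2 * S) - u₂ s * S = S * (k ^ 2 * u s - u₂ s) :=
    fun S s => by ring
  simp only [hswap] at hleft hright
  rw [integral_green_mul hx (((hu.intervalIntegrable hL).const_mul (k ^ 2)).sub
    (hu.intervalIntegrable_deriv₂ hL)), hleft, hright, hu.left, hu.right,
    show k * L = k * (L - x) + k * x by ring, Real.sinh_add]
  simp only [sub_self, mul_zero, Real.sinh_zero]
  ring

theorem integral_green (hk : 0 < k) (hL : 0 < L) (hx : x ∈ Icc 0 L) :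
    ∫ s in 0..L, green k L x s = constResponse k L x / k := by
  have hrep := integral_green_mul_eq (k := k) (dirichletJet_constResponse hL.le k) hx
  simp only [mul_sub, sub_sub_cancel] at hrep
  rw [intervalIntegral.integral_mul_const] at hrep
  have hS := Real.sinh_pos_iff.2 (mul_pos hk hL)
  field_simp
  refine mul_right_cancel₀ (mul_pos hk hS).ne' ?_
  linear_combination hrep

theorem integral_parabolaResponse_mul {u u₁ u₂ : ℝ → ℝ} (hL : 0 ≤ L) (hu : DirichletJet L u u₁ u₂) :
    ∫ s in 0..L, parabolaResponse k L s * (k ^ 2 * u s - u₂ s) =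
      k ^ 4 * Real.sinh (k * L) * ∫ s in 0..L, parabola L s * u s := by
  rw [(dirichletJet_parabolaResponse hL k).integral_mul_sub_comm hL hu,
    ← intervalIntegral.integral_const_mul]
  refine intervalIntegral.integral_congr fun s _ => ?_
  simp only [parabolaResponse]
  ring

end Hyperbolic

/-! ### The maximum principle and solvability -/

/-- Sharp: the difference of the two sides is a positive multiple of `4 k² σ(k L) / L³ - N`. -/
theorem mul_le_integral_parabolaResponse {k L N : ℝ} (hk : 0 < k) (hL : 0 < L) (hN : 0 ≤ N)
    (h : N ≤ 4 * k ^ 2 / L ^ 3 * sigma (k * L)) :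
    N / k * ((Real.cosh (k * L) - 1) *
        (k * L / 2 * Real.sinh (k * L) - (Real.cosh (k * L) - 1))) ≤
      k ^ 4 * Real.sinh (k * L) + N * ∫ s in 0..L, parabolaResponse k L s := by
  have hS : 0 < Real.sinh (k * L) := Real.sinh_pos_iff.2 (mul_pos hk hL)
  rcases hN.eq_or_lt with rfl | hN
  · simpa using (mul_pos (pow_pos hk 4) hS).le
  rw [integral_parabolaResponse hk.ne']
  have hsq := Real.cosh_sq (k * L)
  rw [sigma] at h
  set S := Real.sinh (k * L)
  set C := Real.cosh (k * L)
  set E := 6 * (k * L) * C + 6 * (k * L) - 12 * S - (k * L) ^ 3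
  have hE : 0 < E := by
    by_contra! hE
    exact absurd (hN.trans_le h) (mul_nonpos_of_nonneg_of_nonpos (by positivity)
      (div_nonpos_of_nonneg_of_nonpos (by positivity) hE)).not_gt
  have hNE : N * E ≤ 12 * k ^ 5 := by
    rwa [show 4 * k ^ 2 / L ^ 3 * (3 * (k * L) ^ 3 / E) = 12 * k ^ 5 / E by field_simp; ring,
      le_div_iff₀ hE] at h
  have hdiff : k ^ 4 * S + N * (k ^ 2 * S * (L ^ 3 / 12) - L * S + 2 * (C - 1) / k) -
      N / k * ((C - 1) * (k * L / 2 * S - (C - 1))) = S * (12 * k ^ 5 - N * E) / (12 * k) := by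
    simp only [E]
    field_simp
    linear_combination (24 * N) * hsq
  have : 0 ≤ S * (12 * k ^ 5 - N * E) / (12 * k) :=
    div_nonneg (mul_nonneg hS.le (sub_nonneg.2 hNE)) (by positivity)
  linarith

namespace DirichletJet

variable {k L N : ℝ} {u u₁ u₂ : ℝ → ℝ}

theorem intervalIntegrable_parabola_mul (hL : 0 ≤ L) (hu : DirichletJet L u u₁ u₂) :
    IntervalIntegrable (fun s => parabola L s * u s) volume 0 L :=
  (((dirichletJet_parabola hL).continuousOn_uIcc hL).mul
    (hu.continuousOn_uIcc hL)).intervalIntegrable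

theorem integral_green_sub_parabolaResponse_mul (hk : 0 < k) (hL : 0 < L)
    (hu : DirichletJet L u u₁ u₂) {x : ℝ} (hx : x ∈ Icc 0 L) (r q C : ℝ) :
    ∫ s in 0..L, (r * green k L x s - q * parabolaResponse k L s) * (k ^ 2 * u s - u₂ s + C) =
      r * (k * Real.sinh (k * L) * u x + C * (constResponse k L x / k)) -
        q * (k ^ 4 * Real.sinh (k * L) * (∫ s in 0..L, parabola L s * u s) +
          C * ∫ s in 0..L, parabolaResponse k L s) := by
  have hΦ := dirichletJet_parabolaResponse hL.le k
  have hf : IntervalIntegrable (fun s => k ^ 2 * u s - u₂ s) volume 0 L :=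
    ((hu.intervalIntegrable hL.le).const_mul _).sub (hu.intervalIntegrable_deriv₂ hL.le)
  have hG : IntervalIntegrable (green k L x) volume 0 L :=
    (continuous_green k L x).intervalIntegrable 0 L
  have hGf := (hf.continuousOn_mul (continuous_green k L x).continuousOn).const_mul r
  have hΦf := (hf.continuousOn_mul (hΦ.continuousOn_uIcc hL.le)).const_mul q
  have hGC := hG.const_mul (r * C)
  have hΦC := (hΦ.intervalIntegrable hL.le).const_mul (q * C)
  have hexpand : ∀ s, (r * green k L x s - q * parabolaResponse k L s) *
      (k ^ 2 * u s - u₂ s + C) =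
      (r * (green k L x s * (k ^ 2 * u s - u₂ s)) + r * C * green k L x s) -
      (q * (parabolaResponse k L s * (k ^ 2 * u s - u₂ s)) + q * C * parabolaResponse k L s) :=
    fun s => by ring
  simp only [hexpand]
  rw [intervalIntegral.integral_sub (hGf.add hGC) (hΦf.add hΦC),
    intervalIntegral.integral_add hGf hGC, intervalIntegral.integral_add hΦf hΦC]
  simp only [intervalIntegral.integral_const_mul]
  rw [integral_green_mul_eq hu hx, integral_green hk hL hx, integral_parabolaResponse_mul hL.le hu]
  ring

theorem nonneg_of_nonlocal_nonneg (hk : 0 < k) (hL : 0 < L) (hN : 0 ≤ N)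
    (hNk : N ≤ 4 * k ^ 2 / L ^ 3 * sigma (k * L)) (hu : DirichletJet L u u₁ u₂)
    (h : ∀ᵐ x, x ∈ Ioo 0 L → 0 ≤ k ^ 2 * u x - u₂ x + N * ∫ t in 0..L, parabola L t * u t) :
    ∀ x ∈ Icc 0 L, 0 ≤ u x := by
  intro x hx
  have hS : 0 < Real.sinh (k * L) := Real.sinh_pos_iff.2 (mul_pos hk hL)
  have hA : 0 < k ^ 4 * Real.sinh (k * L) + N * ∫ t in 0..L, parabolaResponse k L t :=
    add_pos_of_pos_of_nonneg (by positivity) (mul_nonneg hN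
      (intervalIntegral.integral_nonneg hL.le fun _ => parabolaResponse_nonneg hk.le))
  set A := k ^ 4 * Real.sinh (k * L) + N * ∫ t in 0..L, parabolaResponse k L t with hA_def
  have hrep := integral_green_sub_parabolaResponse_mul hk hL hu hx A
    (N / k * constResponse k L x) (N * ∫ t in 0..L, parabola L t * u t)
  have hpos : 0 ≤ A * (k * Real.sinh (k * L)) * u x := by
    refine (intervalIntegral.integral_nonneg_of_ae_restrict hL.le (ae_restrict_Icc_iff.2 ?_)).trans
      (hrep.trans (by rw [hA_def]; ring)).le
    filter_upwards [h] with s hs hsI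
    refine mul_nonneg (sub_nonneg.2 ?_) (hs hsI)
    replace hsI := Ioo_subset_Icc_self hsI
    calc N / k * constResponse k L x * parabolaResponse k L s
        ≤ N / k * ((Real.cosh (k * L) - 1) * (k * L / 2 * Real.sinh (k * L) -
            (Real.cosh (k * L) - 1))) * green k L x s := by
          rw [mul_assoc, mul_assoc (N / k)]
          exact mul_le_mul_of_nonneg_left (constResponse_mul_parabolaResponse_le hk.le hx hsI)
            (div_nonneg hN hk.le)
      _ ≤ A * green k L x s :=
        mul_le_mul_of_nonneg_right (mul_le_integral_parabolaResponse hk hL hN hNk)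
          (green_nonneg hk.le hx hsI)
  exact nonneg_of_mul_nonneg_right hpos (mul_pos hA (mul_pos hk hS))

end DirichletJet

theorem exists_w21Jet_eq {k L : ℝ} (hk : k ≠ 0) (hL : 0 ≤ L) {h : ℝ → ℝ}
    (hh : IntervalIntegrable h volume 0 L) :
    ∃ v v₁, W21Jet 0 L v v₁ (fun x => k ^ 2 * v x - h x) ∧ v 0 = 0 := by
  set P := fun x => ∫ t in 0..x, Real.cosh (k * t) * h t with hP
  set Q := fun x => ∫ t in 0..x, Real.sinh (k * t) * h t with hQ
  have hcosh : IntervalIntegrable (fun t => Real.cosh (k * t) * h t) volume 0 L :=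
    hh.continuousOn_mul (by fun_prop)
  have hsinh : IntervalIntegrable (fun t => Real.sinh (k * t) * h t) volume 0 L :=
    hh.continuousOn_mul (by fun_prop)
  have hPac : AbsolutelyContinuousOnInterval P 0 L := absolutelyContinuous_primitive hcosh
  have hQac : AbsolutelyContinuousOnInterval Q 0 L := absolutelyContinuous_primitive hsinh
  have hsac := (w21Jet_sinh_mul hL k).absolutelyContinuous hL
  have hcac : AbsolutelyContinuousOnInterval (fun x => Real.cosh (k * x)) 0 L :=
    absolutelyContinuous_of_hasDerivWithinAt hL
      (fun x _ => (hasDerivAt_cosh_mul k x).hasDerivWithinAt) (by fun_prop)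
  have hP' := ae_hasDerivAt_primitive hcosh
  have hQ' := ae_hasDerivAt_primitive hsinh
  have hvac : AbsolutelyContinuousOnInterval
      (fun x => k⁻¹ * (Real.cosh (k * x) * Q x - Real.sinh (k * x) * P x)) 0 L :=
    ((hcac.mul hQac).sub (hsac.mul hPac)).const_mul k⁻¹
  have hv₁ac : AbsolutelyContinuousOnInterval
      (fun x => Real.sinh (k * x) * Q x - Real.cosh (k * x) * P x) 0 L :=
    (hsac.mul hQac).sub (hcac.mul hPac)
  refine ⟨_, _, ⟨hasDerivWithinAt_of_ae_hasDerivAt hvac ?_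
    (uIcc_of_le hL ▸ hv₁ac.continuousOn), hv₁ac, ?_⟩, by simp [hP, hQ]⟩
  · filter_upwards [hP', hQ'] with x hPx hQx hx
    refine ((((hasDerivAt_cosh_mul k x).mul (hQx hx)).sub
      ((hasDerivAt_sinh_mul k x).mul (hPx hx))).const_mul k⁻¹).congr_deriv ?_
    field_simp
    ring
  · filter_upwards [hP', hQ'] with x hPx hQx hx
    refine (((hasDerivAt_sinh_mul k x).mul (hQx hx)).sub
      ((hasDerivAt_cosh_mul k x).mul (hPx hx))).congr_deriv ?_
    field_simp
    linear_combination -(h x) * Real.cosh_sq (k * x)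

theorem exists_dirichletJet_eq {k L : ℝ} (hk : 0 < k) (hL : 0 < L) {h : ℝ → ℝ}
    (hh : IntervalIntegrable h volume 0 L) :
    ∃ u u₁, DirichletJet L u u₁ (fun x => k ^ 2 * u x - h x) := by
  obtain ⟨v, v₁, hv, hv0⟩ := exists_w21Jet_eq hk.ne' hL.le hh
  have hS := (Real.sinh_pos_iff.2 (mul_pos hk hL)).ne'
  have hjet := hv.sub ((w21Jet_sinh_mul hL.le k).const_mul (v L / Real.sinh (k * L)))
  exact ⟨_, _, hjet.congr_ae (.of_forall fun x _ => by ring), by simp [hv0],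
    by rw [div_mul_cancel₀ _ hS, sub_self]⟩

theorem exists_dirichletJet_nonlocal_eq {k L N : ℝ} (hk : 0 < k) (hL : 0 < L) (hN : 0 ≤ N)
    {h : ℝ → ℝ} (hh : IntervalIntegrable h volume 0 L) :
    ∃ u u₁ u₂, DirichletJet L u u₁ u₂ ∧
      ∀ x, k ^ 2 * u x - u₂ x + N * (∫ t in 0..L, parabola L t * u t) = h x := by
  obtain ⟨v, v₁, hv⟩ := exists_dirichletJet_eq hk hL hh
  have hT := dirichletJet_constResponse hL.le k
  have hden : 0 < k ^ 2 * Real.sinh (k * L) + N * ∫ t in 0..L, parabola L t * constResponse k L t :=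
    add_pos_of_pos_of_nonneg
      (mul_pos (pow_pos hk 2) (Real.sinh_pos_iff.2 (mul_pos hk hL)))
      (mul_nonneg hN (intervalIntegral.integral_nonneg hL.le fun _ hx =>
        mul_nonneg (parabola_nonneg hx) (constResponse_nonneg hk.le hx)))
  set r := N * (∫ t in 0..L, parabola L t * v t) /
    (k ^ 2 * Real.sinh (k * L) + N * ∫ t in 0..L, parabola L t * constResponse k L t) with hr
  refine ⟨_, _, _, hv.sub (hT.const_mul r), fun x => ?_⟩
  simp only [mul_sub, mul_left_comm _ r]
  rw [intervalIntegral.integral_sub (hv.intervalIntegrable_parabola_mul hL.le)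
    ((hT.intervalIntegrable_parabola_mul hL.le).const_mul r), intervalIntegral.integral_const_mul]
  rw [eq_div_iff hden.ne'] at hr
  linear_combination -hr

/-! ### The fourth-order operator -/

section IteratedDeriv

variable {L : ℝ} {y z f f' : ℝ → ℝ}

theorem D_congr (k : ℕ) (h : EqOn y z (Icc 0 L)) : EqOn (D L k y) (D L k z) (Icc 0 L) :=
  iteratedDerivWithin_congr h

theorem D_succ_eq_derivWithin (L : ℝ) (k : ℕ) (y : ℝ → ℝ) :
    D L (k + 1) y = derivWithin (D L k y) (Icc 0 L) :=
  iteratedDerivWithin_succ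

theorem hasDerivWithinAt_D {n k : ℕ} (hL : 0 < L) (hy : ContDiffOn ℝ n y (Icc 0 L)) (hk : k < n) :
    ∀ x ∈ Icc 0 L, HasDerivWithinAt (D L k y) (D L (k + 1) y x) (Icc 0 L) x := by
  intro x hx
  rw [D_succ_eq_derivWithin]
  exact (hy.differentiableOn_iteratedDerivWithin (by exact_mod_cast hk)
    (uniqueDiffOn_Icc hL) x hx).hasDerivWithinAt

theorem D_succ_eqOn {k : ℕ} (hL : 0 < L) (h : EqOn (D L k y) f (Icc 0 L))
    (hf : ∀ x ∈ Icc 0 L, HasDerivWithinAt f (f' x) (Icc 0 L) x) :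
    EqOn (D L (k + 1) y) f' (Icc 0 L) := by
  intro x hx
  rw [D_succ_eq_derivWithin]
  exact ((hf x hx).congr h (h hx)).derivWithin (uniqueDiffOn_Icc hL x hx)

theorem D_succ_eq_deriv {x : ℝ} {k : ℕ} (h : EqOn (D L k y) f (Icc 0 L)) (hx : x ∈ Ioo 0 L) :
    D L (k + 1) y x = deriv f x := by
  have hnhds := Icc_mem_nhds hx.1 hx.2
  rw [D_succ_eq_derivWithin, derivWithin_of_mem_nhds hnhds]
  exact (h.eventuallyEq_of_mem hnhds).deriv_eq

theorem continuousOn_D_two (hL : 0 < L) (hy : ContDiffOn ℝ 2 y (Icc 0 L)) :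
    ContinuousOn (D L 2 y) (Icc 0 L) :=
  hy.continuousOn_iteratedDerivWithin (by norm_num) (uniqueDiffOn_Icc hL)

theorem dirichletJet_of_contDiffOn (hL : 0 < L) (hy : ContDiffOn ℝ 2 y (Icc 0 L)) (h₀ : y 0 = 0)
    (h₁ : y L = 0) : DirichletJet L y (D L 1 y) (D L 2 y) where
  toW21Jet := .of_hasDerivWithinAt hL.le
    (by simpa only [D, iteratedDerivWithin_zero] using
      hasDerivWithinAt_D (k := 0) (n := 2) hL hy (by norm_num))
    (hasDerivWithinAt_D (n := 2) hL hy (by norm_num)) (continuousOn_D_two hL hy)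
  left := h₀
  right := h₁

theorem contDiffOn_two_of_hasDerivWithinAt {y₁ y₂ : ℝ → ℝ} (hL : 0 < L)
    (h₁ : ∀ x ∈ Icc 0 L, HasDerivWithinAt y (y₁ x) (Icc 0 L) x)
    (h₂ : ∀ x ∈ Icc 0 L, HasDerivWithinAt y₁ (y₂ x) (Icc 0 L) x)
    (hcont : ContinuousOn y₂ (Icc 0 L)) :
    ContDiffOn ℝ 2 y (Icc 0 L) ∧ EqOn (D L 2 y) y₂ (Icc 0 L) := by
  have hD₁ : EqOn (D L 1 y) y₁ (Icc 0 L) :=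
    D_succ_eqOn hL (k := 0) (by simp only [D, iteratedDerivWithin_zero, eqOn_refl]) h₁
  have hD₂ := D_succ_eqOn hL hD₁ h₂
  refine ⟨?_, hD₂⟩
  have hy₁ : ContDiffOn ℝ 1 (D L 1 y) (Icc 0 L) := by
    rw [contDiffOn_one_iff_derivWithin (uniqueDiffOn_Icc hL), ← D_succ_eq_derivWithin]
    exact ⟨.congr (fun x hx => (h₂ x hx).differentiableWithinAt) hD₁, hcont.congr hD₂⟩
  have hy : ContDiffOn ℝ 1 y (Icc 0 L) := by
    rw [contDiffOn_one_iff_derivWithin (uniqueDiffOn_Icc hL), ← iteratedDerivWithin_one]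
    exact ⟨fun x hx => (h₁ x hx).differentiableWithinAt, hy₁.continuousOn⟩
  exact (contDiffOn_nat_succ_iff_contDiffOn_one_iteratedDerivWithin (n := 1)
    (uniqueDiffOn_Icc hL)).2 ⟨hy, hy₁⟩

theorem exists_contDiffOn_D_two_eqOn (hL : 0 < L) (hf : ContinuousOn f (Icc 0 L)) :
    ∃ w, ContDiffOn ℝ 2 w (Icc 0 L) ∧ EqOn (D L 2 w) f (Icc 0 L) ∧ w 0 = 0 ∧ w L = 0 := by
  set g : ℝ → ℝ := IccExtend hL.le ((Icc 0 L).domRestrict f) with hg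
  have hgcont : Continuous g := hf.domRestrict.Icc_extend'
  have hgf : EqOn g f (Icc 0 L) := fun x hx => by rw [hg, IccExtend_of_mem _ _ hx]; rfl
  set G : ℝ → ℝ := fun x => ∫ s in (0 : ℝ)..x, g s
  have hG : ∀ x, HasDerivAt G (g x) x := fun x => (hgcont.integral_hasStrictDerivAt 0 x).hasDerivAt
  have hGcont : Continuous G := continuous_iff_continuousAt.2 fun x => (hG x).continuousAt
  set H : ℝ → ℝ := fun x => ∫ s in (0 : ℝ)..x, G s with hHdef
  have hH : ∀ x, HasDerivAt H (G x) x := fun x => (hGcont.integral_hasStrictDerivAt 0 x).hasDerivAt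
  obtain ⟨hC2, hD₂⟩ := contDiffOn_two_of_hasDerivWithinAt (y := fun x => H x - x * (H L / L))
    (y₁ := fun x => G x - 1 * (H L / L)) hL
    (fun x _ => ((hH x).sub ((hasDerivAt_id x).mul_const _)).hasDerivWithinAt)
    (fun x _ => ((hG x).sub_const _).hasDerivWithinAt) hgcont.continuousOn
  exact ⟨_, hC2, hD₂.trans hgf, by simp [hHdef], by field_simp; ring⟩

theorem MemW41.contDiffOn (hy : MemW41 L y) : ContDiffOn ℝ 2 y (Icc 0 L) :=
  hy.1.of_le (by norm_num)

theorem dirichletJet_of_memW41 (hL : 0 < L) (hy : MemW41 L y) (hbc : NavierBC L y) :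
    DirichletJet L y (D L 1 y) (D L 2 y) :=
  dirichletJet_of_contDiffOn hL hy.contDiffOn hbc.1 hbc.2.1

theorem dirichletJet_D_two (hL : 0 < L) (hy : MemW41 L y) (hbc : NavierBC L y) :
    DirichletJet L (D L 2 y) (D L 3 y) (D L 4 y) where
  deriv := hasDerivWithinAt_D (n := 3) hL hy.1 (by norm_num)
  ac := hy.2
  ae_deriv := by
    filter_upwards [hy.2.ae_differentiableAt] with x hdiff hx
    rw [D_succ_eq_deriv (eqOn_refl _ _) hx]
    exact (hdiff (uIcc_of_le hL.le ▸ Ioo_subset_Icc_self hx)).hasDerivAt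
  left := hbc.2.2.1
  right := hbc.2.2.2

theorem memW41_of_D_two_eqOn {v v₁ v₂ : ℝ → ℝ} (hL : 0 < L) (hy : ContDiffOn ℝ 2 y (Icc 0 L))
    (hv : W21Jet 0 L v v₁ v₂) (h : EqOn (D L 2 y) v (Icc 0 L)) :
    MemW41 L y ∧ ∀ᵐ x, x ∈ Ioo 0 L → D L 4 y x = v₂ x := by
  have hD₃ : EqOn (D L 3 y) v₁ (Icc 0 L) := D_succ_eqOn hL h hv.deriv
  have hcont : ContinuousOn v₁ (Icc 0 L) := uIcc_of_le hL.le ▸ hv.ac.continuousOn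
  have hD₂ : ContDiffOn ℝ 1 (D L 2 y) (Icc 0 L) := by
    rw [contDiffOn_one_iff_derivWithin (uniqueDiffOn_Icc hL), ← D_succ_eq_derivWithin]
    exact ⟨.congr (fun x hx => (hv.deriv x hx).differentiableWithinAt) h, hcont.congr hD₃⟩
  refine ⟨⟨(contDiffOn_nat_succ_iff_contDiffOn_one_iteratedDerivWithin (n := 2)
    (uniqueDiffOn_Icc hL)).2 ⟨hy, hD₂⟩,
    absolutelyContinuous_congr hv.ac (uIcc_of_le hL.le ▸ hD₃.symm)⟩, ?_⟩
  filter_upwards [hv.ae_deriv] with x hx hxI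
  rw [D_succ_eq_deriv hD₃ hxI, (hx hxI).deriv]

end IteratedDeriv

/-- The order of the monotone iteration: `u ≤ v` and `v'' ≤ u''` on `[0, L]`. -/
def Precedes (L : ℝ) (u v : ℝ → ℝ) : Prop :=
  ∀ x ∈ Icc 0 L, u x ≤ v x ∧ D L 2 v x ≤ D L 2 u x

section Precedes

variable {L : ℝ} {u v w u₁ v₁ : ℝ → ℝ}

theorem Precedes.refl (L : ℝ) (u : ℝ → ℝ) : Precedes L u u := fun _ _ => ⟨le_rfl, le_rfl⟩

theorem Precedes.trans (huv : Precedes L u v) (hvw : Precedes L v w) : Precedes L u w :=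
  fun x hx => ⟨(huv x hx).1.trans (hvw x hx).1, (hvw x hx).2.trans (huv x hx).2⟩

theorem precedes_of_D_two_le (hu : DirichletJet L u u₁ (D L 2 u))
    (hv : DirichletJet L v v₁ (D L 2 v)) (h : ∀ x ∈ Icc 0 L, D L 2 v x ≤ D L 2 u x) :
    Precedes L u v := fun x hx =>
  ⟨sub_nonneg.1 ((hv.sub hu).nonneg
    (.of_forall fun y hy => sub_nonpos.2 (h y (Ioo_subset_Icc_self hy))) x hx), h x hx⟩

theorem Precedes.integral_le (hL : 0 ≤ L) (h : Precedes L u v) (hu : ContinuousOn u (Icc 0 L))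
    (hv : ContinuousOn v (Icc 0 L)) : ∫ t in 0..L, u t ≤ ∫ t in 0..L, v t := by
  rw [← uIcc_of_le hL] at hu hv
  exact intervalIntegral.integral_mono_on hL hu.intervalIntegrable hv.intervalIntegrable
    fun x hx => (h x hx).1

theorem mem_orderInterval_iff {α β : ℝ → ℝ} : u ∈ orderInterval L α β ↔
    ContDiffOn ℝ 2 u (Icc 0 L) ∧ Precedes L α u ∧ Precedes L u β := by
  simp only [orderInterval, Precedes, mem_ofPred_eq]
  grind

end Precedes

section LinearOperator

variable {L M N : ℝ} {y z : ℝ → ℝ}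

theorem linOp_eq_sub_integral_parabola_mul (hL : 0 < L) (hy : MemW41 L y) (hbc : NavierBC L y)
    (M N x : ℝ) :
    linOp L M N y x =
      D L 4 y x - M * D L 2 y x - N * ∫ t in 0..L, parabola L t * D L 2 y t := by
  rw [linOp, (dirichletJet_of_memW41 hL hy hbc).integral_eq_neg_integral_parabola_mul hL.le]
  ring

theorem precedes_of_linOp_le (hL : 0 < L) (hM : 0 < M) (hN : 0 ≤ N)
    (hNM : N ≤ 4 * M / L ^ 3 * sigma (Real.sqrt M * L)) (hy : MemW41 L y) (hybc : NavierBC L y)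
    (hz : MemW41 L z) (hzbc : NavierBC L z)
    (h : ∀ᵐ x, x ∈ Ioo 0 L → linOp L M N y x ≤ linOp L M N z x) : Precedes L y z := by
  have hJy := dirichletJet_D_two hL hy hybc
  have hJz := dirichletJet_D_two hL hz hzbc
  refine precedes_of_D_two_le (dirichletJet_of_memW41 hL hy hybc)
    (dirichletJet_of_memW41 hL hz hzbc) fun x hx => sub_nonneg.1 ?_
  refine (hJy.sub hJz).nonneg_of_nonlocal_nonneg (Real.sqrt_pos.2 hM) hL hN
    (by rwa [Real.sq_sqrt hM.le]) ?_ x hx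
  filter_upwards [h] with x hle hx
  have := hle hx
  rw [linOp_eq_sub_integral_parabola_mul hL hy hybc,
    linOp_eq_sub_integral_parabola_mul hL hz hzbc] at this
  simp only [mul_sub, Real.sq_sqrt hM.le]
  rw [intervalIntegral.integral_sub (hJy.intervalIntegrable_parabola_mul hL.le)
    (hJz.intervalIntegrable_parabola_mul hL.le)]
  linarith

theorem exists_linOp_eq (hL : 0 < L) (hM : 0 < M) (hN : 0 ≤ N) {h : ℝ → ℝ}
    (hh : IntervalIntegrable h volume 0 L) :
    ∃ y, MemW41 L y ∧ NavierBC L y ∧ ∀ᵐ x, x ∈ Ioo 0 L → linOp L M N y x = h x := by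
  obtain ⟨u, u₁, u₂, hu, heq⟩ := exists_dirichletJet_nonlocal_eq (Real.sqrt_pos.2 hM) hL hN hh
  have hneg := hu.const_mul (-1)
  obtain ⟨y, hy, hD₂, h₀, h₁⟩ := exists_contDiffOn_D_two_eqOn hL hneg.continuousOn
  obtain ⟨hmem, hD₄⟩ := memW41_of_D_two_eqOn hL hy hneg.toW21Jet hD₂
  have hbc : NavierBC L y := ⟨h₀, h₁, (hD₂ (left_mem_Icc.2 hL.le)).trans hneg.left,
    (hD₂ (right_mem_Icc.2 hL.le)).trans hneg.right⟩
  have hint : ∫ t in 0..L, parabola L t * D L 2 y t = -∫ t in 0..L, parabola L t * u t := by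
    rw [← intervalIntegral.integral_neg]
    refine intervalIntegral.integral_congr fun t ht => ?_
    simp only [hD₂ (uIcc_of_le hL.le ▸ ht)]
    ring
  refine ⟨y, hmem, hbc, ?_⟩
  filter_upwards [hD₄] with x hx hxI
  rw [linOp_eq_sub_integral_parabola_mul hL hmem hbc, hx hxI, hD₂ (Ioo_subset_Icc_self hxI), hint,
    ← heq x, Real.sq_sqrt hM.le]
  ring

end LinearOperator

/-! ### The iteration step -/

section Step

variable {L a b c M N : ℝ} {p u v u' v' w : ℝ → ℝ}

theorem exists_isStep (hL : 0 < L) (hM : 0 < M) (hN : 0 ≤ N) (hp : IntervalIntegrable p volume 0 L)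
    (hu : ContDiffOn ℝ 2 u (Icc 0 L)) : ∃ u', IsStep L a b c M N p u u' := by
  have hD₂ : IntervalIntegrable (D L 2 u) volume 0 L := by
    refine ContinuousOn.intervalIntegrable ?_
    exact (uIcc_of_le hL.le).symm ▸ continuousOn_D_two hL hu
  exact exists_linOp_eq hL hM hN <|
    ((((hp.add (hD₂.const_mul a)).add ((hD₂.const_mul b).mul_const _)).sub
      intervalIntegrable_const).sub (hD₂.const_mul M)).add intervalIntegrable_const

theorem IsStep.linOp_sub_linOp (hu : IsStep L a b c M N p u u') (hv : IsStep L a b c M N p v v') :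
    ∀ᵐ x, x ∈ Ioo 0 L → linOp L M N v' x - linOp L M N u' x =
      (M - (a + b * ∫ t in 0..L, v t)) * (D L 2 u x - D L 2 v x) +
        (N - (c - b * D L 2 u x)) * ((∫ t in 0..L, v t) - ∫ t in 0..L, u t) := by
  filter_upwards [hu.2.2, hv.2.2] with x hux hvx hx
  rw [hux hx, hvx hx, nonlin, nonlin]
  ring

theorem IsStep.eqOn (hL : 0 < L) (hM : 0 < M) (hN : 0 ≤ N)
    (hNM : N ≤ 4 * M / L ^ 3 * sigma (Real.sqrt M * L)) (huv : EqOn u v (Icc 0 L))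
    (hu : IsStep L a b c M N p u u') (hv : IsStep L a b c M N p v v') :
    EqOn u' v' (Icc 0 L) := by
  have hint : ∫ t in 0..L, u t = ∫ t in 0..L, v t :=
    intervalIntegral.integral_congr (uIcc_of_le hL.le ▸ huv)
  have heq : ∀ᵐ x, x ∈ Ioo 0 L → linOp L M N u' x = linOp L M N v' x := by
    filter_upwards [hu.linOp_sub_linOp hv] with x h hx
    have := h hx
    rw [hint, D_congr 2 huv (Ioo_subset_Icc_self hx)] at this
    linarith
  have hle := precedes_of_linOp_le hL hM hN hNM hu.1 hu.2.1 hv.1 hv.2.1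
    (heq.mono fun x h hx => (h hx).le)
  have hge := precedes_of_linOp_le hL hM hN hNM hv.1 hv.2.1 hu.1 hu.2.1
    (heq.mono fun x h hx => (h hx).ge)
  exact fun x hx => le_antisymm (hle x hx).1 (hge x hx).1

theorem isStep_self_of_isSolution (h : IsSolution L a b c p w) : IsStep L a b c M N p w w := by
  refine ⟨h.1, h.2.1, ?_⟩
  filter_upwards [h.2.2] with x hx hxI
  have := hx hxI
  simp only [melanOp, linOp, nonlin] at this ⊢
  linarith

theorem isSolution_of_isStep_of_eqOn (hL : 0 < L) (h : IsStep L a b c M N p u u')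
    (huu' : EqOn u u' (Icc 0 L)) : IsSolution L a b c p u' := by
  refine ⟨h.1, h.2.1, ?_⟩
  have hint : ∫ t in 0..L, u t = ∫ t in 0..L, u' t :=
    intervalIntegral.integral_congr (uIcc_of_le hL.le ▸ huu')
  filter_upwards [h.2.2] with x hx hxI
  have := hx hxI
  simp only [melanOp, linOp, nonlin, hint, D_congr 2 huu' (Ioo_subset_Icc_self hxI)] at this ⊢
  linarith

end Step

/-- The factor by which one iteration step contracts the distance of the second derivatives of
comparable functions of `[α, β]`. -/
noncomputable def contractionRate (L a b c M N : ℝ) (α : ℝ → ℝ) : ℝ :=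
  L ^ 2 / 8 * (M - (a + b * ∫ t in 0..L, α t)) + L ^ 5 / 64 * (N - c)

section Hypotheses

variable {L a b c M N : ℝ} {α β : ℝ → ℝ}

theorem sub_mul_D_two_le_of_sub_mul_sInf_le (hL : 0 < L) (hb : 0 ≤ b)
    (hβ : ContDiffOn ℝ 2 β (Icc 0 L)) (h : c - b * sInf (D L 2 β '' Icc 0 L) ≤ N) :
    ∀ x ∈ Icc 0 L, c - b * D L 2 β x ≤ N := by
  intro x hx
  have hbdd := (isCompact_Icc.image_of_continuousOn (continuousOn_D_two hL hβ)).bddBelow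
  linarith [mul_le_mul_of_nonneg_left (csInf_le hbdd (mem_image_of_mem _ hx)) hb]

theorem NavierBC.le_of_sub_mul_D_two_le (hL : 0 ≤ L) (hβ : NavierBC L β)
    (h : ∀ x ∈ Icc 0 L, c - b * D L 2 β x ≤ N) : c ≤ N := by
  simpa only [hβ.2.2.1, mul_zero, sub_zero] using h 0 (left_mem_Icc.2 hL)

theorem contractionRate_lt_one (hL : 0 < L) (hcN : c ≤ N)
    (h : a + b * (∫ x in (0 : ℝ)..L, α x) + L ^ 3 / 4 * c > L ^ 3 * N / 4 + M - 4 / L ^ 2) :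
    contractionRate L a b c M N α < 1 := by
  have hN : 0 ≤ L ^ 5 / 64 * (N - c) := mul_nonneg (by positivity) (sub_nonneg.2 hcN)
  have hscale : L ^ 2 / 8 * (M - (a + b * ∫ x in 0..L, α x) + L ^ 3 / 4 * (N - c)) <
      L ^ 2 / 8 * (4 / L ^ 2) := mul_lt_mul_of_pos_left (by linarith) (by positivity)
  have hhalf : L ^ 2 / 8 * (4 / L ^ 2) = 1 / 2 := by field_simp; norm_num
  unfold contractionRate
  linarith

end Hypotheses

/-- The standing hypotheses of the monotone iteration on `[α, β]`, with the bound on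
`c - b min β''` expressed pointwise. -/
structure Admissible (L a b c M N : ℝ) (p α β : ℝ → ℝ) : Prop where
  hL : 0 < L
  hb : 0 ≤ b
  hM : 0 < M
  hN : 0 ≤ N
  hNM : N ≤ 4 * M / L ^ 3 * sigma (Real.sqrt M * L)
  hp : IntervalIntegrable p volume 0 L
  lower : IsLowerSolution L a b c p α
  upper : IsUpperSolution L a b c p β
  concave : ∀ x ∈ Icc 0 L, D L 2 α x ≤ 0
  D_two_le : ∀ x ∈ Icc 0 L, D L 2 β x ≤ D L 2 α x
  le_M : a + b * (∫ x in 0..L, β x) ≤ M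
  le_N : ∀ x ∈ Icc 0 L, c - b * D L 2 β x ≤ N
  rate_lt_one : contractionRate L a b c M N α < 1

namespace Admissible

variable {L a b c M N : ℝ} {p α β u v u' v' : ℝ → ℝ}

theorem precedes (S : Admissible L a b c M N p α β) : Precedes L α β :=
  precedes_of_D_two_le (dirichletJet_of_memW41 S.hL S.lower.1 S.lower.2.1)
    (dirichletJet_of_memW41 S.hL S.upper.1 S.upper.2.1) S.D_two_le

theorem lower_mem (S : Admissible L a b c M N p α β) : α ∈ orderInterval L α β :=
  mem_orderInterval_iff.2 ⟨S.lower.1.contDiffOn, .refl L α, S.precedes⟩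

theorem upper_mem (S : Admissible L a b c M N p α β) : β ∈ orderInterval L α β :=
  mem_orderInterval_iff.2 ⟨S.upper.1.contDiffOn, S.precedes, .refl L β⟩

theorem dirichletJet (S : Admissible L a b c M N p α β) (hu : u ∈ orderInterval L α β) :
    DirichletJet L u (D L 1 u) (D L 2 u) := by
  obtain ⟨hC, hα, hβ⟩ := mem_orderInterval_iff.1 hu
  have h₀ := left_mem_Icc.2 S.hL.le
  have h₁ := right_mem_Icc.2 S.hL.le
  obtain ⟨-, ⟨hα₀, hα₁, -⟩, -⟩ := S.lower
  obtain ⟨-, ⟨hβ₀, hβ₁, -⟩, -⟩ := S.upper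
  exact dirichletJet_of_contDiffOn S.hL hC
    (le_antisymm ((hβ 0 h₀).1.trans_eq hβ₀) (hα₀.symm.trans_le (hα 0 h₀).1))
    (le_antisymm ((hβ L h₁).1.trans_eq hβ₁) (hα₁.symm.trans_le (hα L h₁).1))

theorem integral_le (S : Admissible L a b c M N p α β) (hu : u ∈ orderInterval L α β)
    (hv : v ∈ orderInterval L α β) (huv : Precedes L u v) :
    ∫ t in 0..L, u t ≤ ∫ t in 0..L, v t :=
  huv.integral_le S.hL.le hu.1.continuousOn hv.1.continuousOn

theorem add_mul_integral_le (S : Admissible L a b c M N p α β) (hu : u ∈ orderInterval L α β) :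
    a + b * (∫ t in 0..L, u t) ≤ M := by
  have hint := S.integral_le hu S.upper_mem (mem_orderInterval_iff.1 hu).2.2
  linarith [S.le_M, mul_le_mul_of_nonneg_left hint S.hb]

theorem sub_mul_D_two_le (S : Admissible L a b c M N p α β) (hu : u ∈ orderInterval L α β) {x : ℝ}
    (hx : x ∈ Icc 0 L) : c - b * D L 2 u x ≤ N := by
  linarith [S.le_N x hx, mul_le_mul_of_nonneg_left (hu.2 x hx).2.1 S.hb]

theorem c_le_N (S : Admissible L a b c M N p α β) : c ≤ N :=
  S.upper.2.1.le_of_sub_mul_D_two_le S.hL.le S.le_N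

theorem rate_nonneg (S : Admissible L a b c M N p α β) : 0 ≤ contractionRate L a b c M N α := by
  have := S.hL
  have := sub_nonneg.2 (S.add_mul_integral_le S.lower_mem)
  have := sub_nonneg.2 S.c_le_N
  unfold contractionRate
  positivity

theorem exists_step (S : Admissible L a b c M N p α β) (hu : u ∈ orderInterval L α β) :
    ∃ u', IsStep L a b c M N p u u' :=
  exists_isStep S.hL S.hM S.hN S.hp hu.1

theorem step_mono (S : Admissible L a b c M N p α β) (hu : u ∈ orderInterval L α β)
    (hv : v ∈ orderInterval L α β) (huv : Precedes L u v) (hu' : IsStep L a b c M N p u u')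
    (hv' : IsStep L a b c M N p v v') : Precedes L u' v' := by
  refine precedes_of_linOp_le S.hL S.hM S.hN S.hNM hu'.1 hu'.2.1 hv'.1 hv'.2.1 ?_
  filter_upwards [hu'.linOp_sub_linOp hv'] with x heq hx
  have hx' := Ioo_subset_Icc_self hx
  rw [← sub_nonneg, heq hx]
  exact add_nonneg
    (mul_nonneg (sub_nonneg.2 (S.add_mul_integral_le hv)) (sub_nonneg.2 (huv x hx').2))
    (mul_nonneg (sub_nonneg.2 (S.sub_mul_D_two_le hu hx')) (sub_nonneg.2 (S.integral_le hu hv huv)))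

theorem lower_precedes_step (S : Admissible L a b c M N p α β) (hu' : IsStep L a b c M N p α u') :
    Precedes L α u' := by
  refine precedes_of_linOp_le S.hL S.hM S.hN S.hNM S.lower.1 S.lower.2.1 hu'.1 hu'.2.1 ?_
  filter_upwards [hu'.2.2, S.lower.2.2] with x heq hle hx
  have := hle hx
  rw [heq hx]
  simp only [melanOp, linOp, nonlin] at this ⊢
  linarith

theorem step_precedes_upper (S : Admissible L a b c M N p α β) (hu' : IsStep L a b c M N p β u') :
    Precedes L u' β := by
  refine precedes_of_linOp_le S.hL S.hM S.hN S.hNM hu'.1 hu'.2.1 S.upper.1 S.upper.2.1 ?_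
  filter_upwards [hu'.2.2, S.upper.2.2] with x heq hle hx
  have := hle hx
  rw [heq hx]
  simp only [melanOp, linOp, nonlin] at this ⊢
  linarith

theorem step_mem (S : Admissible L a b c M N p α β) (hu : u ∈ orderInterval L α β)
    (hu' : IsStep L a b c M N p u u') : u' ∈ orderInterval L α β := by
  obtain ⟨α', hα'⟩ := S.exists_step S.lower_mem
  obtain ⟨β', hβ'⟩ := S.exists_step S.upper_mem
  obtain ⟨-, hαu, huβ⟩ := mem_orderInterval_iff.1 hu
  exact mem_orderInterval_iff.2 ⟨hu'.1.contDiffOn,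
    (S.lower_precedes_step hα').trans (S.step_mono S.lower_mem hu hαu hα' hu'),
    (S.step_mono hu S.upper_mem huβ hu' hβ').trans (S.step_precedes_upper hβ')⟩

theorem sub_le_of_D_two_sub_le (S : Admissible L a b c M N p α β) (hu : u ∈ orderInterval L α β)
    (hv : v ∈ orderInterval L α β) {δ : ℝ} (hδ : 0 ≤ δ)
    (h : ∀ x ∈ Icc 0 L, D L 2 u x - D L 2 v x ≤ δ) :
    ∀ x ∈ Icc 0 L, v x - u x ≤ δ * (L ^ 2 / 8) :=
  ((S.dirichletJet hv).sub (S.dirichletJet hu)).le_mul_sq hδ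
    (.of_forall fun x hx => by linarith [h x (Ioo_subset_Icc_self hx)])

theorem integral_sub_le_of_D_two_sub_le (S : Admissible L a b c M N p α β)
    (hu : u ∈ orderInterval L α β) (hv : v ∈ orderInterval L α β) {δ : ℝ} (hδ : 0 ≤ δ)
    (h : ∀ x ∈ Icc 0 L, D L 2 u x - D L 2 v x ≤ δ) :
    (∫ t in 0..L, v t) - ∫ t in 0..L, u t ≤ δ * (L ^ 3 / 8) := by
  have hL := S.hL.le
  have hu' := (S.dirichletJet hu).intervalIntegrable hL
  have hv' := (S.dirichletJet hv).intervalIntegrable hL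
  calc (∫ t in 0..L, v t) - ∫ t in 0..L, u t = ∫ t in 0..L, (v t - u t) :=
        (intervalIntegral.integral_sub hv' hu').symm
    _ ≤ ∫ _ in 0..L, δ * (L ^ 2 / 8) := intervalIntegral.integral_mono_on hL (hv'.sub hu')
        intervalIntegrable_const (S.sub_le_of_D_two_sub_le hu hv hδ h)
    _ = δ * (L ^ 3 / 8) := by rw [intervalIntegral.integral_const, smul_eq_mul]; ring

theorem linOp_step_sub_le (S : Admissible L a b c M N p α β) {δ : ℝ} (hδ : 0 ≤ δ)
    (hu : u ∈ orderInterval L α β) (hv : v ∈ orderInterval L α β) (huv : Precedes L u v)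
    (hu' : IsStep L a b c M N p u u') (hv' : IsStep L a b c M N p v v')
    (h : ∀ x ∈ Icc 0 L, D L 2 u x - D L 2 v x ≤ δ) :
    ∀ᵐ x, x ∈ Ioo 0 L → linOp L M N v' x - linOp L M N u' x ≤
      (M - (a + b * ∫ t in 0..L, α t)) * δ + (N - c) * (δ * (L ^ 3 / 8)) := by
  have hαv := S.integral_le S.lower_mem hv (mem_orderInterval_iff.1 hv).2.1
  have hint := sub_nonneg.2 (S.integral_le hu hv huv)
  filter_upwards [hu'.linOp_sub_linOp hv'] with x heq hx
  have hx' := Ioo_subset_Icc_self hx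
  have hconcave : D L 2 u x ≤ 0 := (hu.2 x hx').2.2.trans (S.concave x hx')
  rw [heq hx]
  refine add_le_add (mul_le_mul ?_ (h x hx') (sub_nonneg.2 (huv x hx').2)
    (sub_nonneg.2 (S.add_mul_integral_le S.lower_mem))) (mul_le_mul ?_
    (S.integral_sub_le_of_D_two_sub_le hu hv hδ h) hint (sub_nonneg.2 S.c_le_N))
  · linarith [mul_le_mul_of_nonneg_left hαv S.hb]
  · linarith [mul_nonpos_of_nonneg_of_nonpos S.hb hconcave]

theorem step_contr (S : Admissible L a b c M N p α β) {δ : ℝ} (hδ : 0 ≤ δ)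
    (hu : u ∈ orderInterval L α β) (hv : v ∈ orderInterval L α β) (huv : Precedes L u v)
    (hu' : IsStep L a b c M N p u u') (hv' : IsStep L a b c M N p v v')
    (h : ∀ x ∈ Icc 0 L, D L 2 u x - D L 2 v x ≤ δ) :
    ∀ x ∈ Icc 0 L, D L 2 u' x - D L 2 v' x ≤ contractionRate L a b c M N α * δ := by
  have hpre := S.step_mono hu hv huv hu' hv'
  have hint := mul_nonneg S.hN
    (sub_nonneg.2 (S.integral_le (S.step_mem hu hu') (S.step_mem hv hv') hpre))
  have hL := S.hL
  have hM := sub_nonneg.2 (S.add_mul_integral_le S.lower_mem)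
  have hN := sub_nonneg.2 S.c_le_N
  have hjet := (dirichletJet_D_two hL hu'.1 hu'.2.1).sub (dirichletJet_D_two hL hv'.1 hv'.2.1)
  intro x hx
  refine (hjet.le_mul_sq
    (R := (M - (a + b * ∫ t in 0..L, α t)) * δ + (N - c) * (δ * (L ^ 3 / 8)))
    (by positivity) ?_ x hx).trans_eq (by unfold contractionRate; ring)
  filter_upwards [S.linOp_step_sub_le hδ hu hv huv hu' hv' h] with y hle hy
  have hD₂ := mul_nonneg S.hM.le (sub_nonneg.2 (hpre y (Ioo_subset_Icc_self hy)).2)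
  have := hle hy
  simp only [linOp] at this
  linarith

end Admissible

/-! ### The iteration -/

theorem tendstoUniformlyOn_of_mem_Icc {ι X : Type*} {l : Filter ι} {s : Set X}
    {lo hi f : ι → X → ℝ} {g : X → ℝ}
    (h : TendstoUniformlyOn (fun i x => hi i x - lo i x) (fun _ => 0) l s)
    (hf : ∀ i, ∀ x ∈ s, f i x ∈ Icc (lo i x) (hi i x))
    (hg : ∀ i, ∀ x ∈ s, g x ∈ Icc (lo i x) (hi i x)) : TendstoUniformlyOn f g l s := by
  rw [Metric.tendstoUniformlyOn_iff] at h ⊢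
  intro ε hε
  filter_upwards [h ε hε] with i hlt x hx
  refine (Real.dist_le_of_mem_Icc (hg i x hx) (hf i x hx)).trans_lt ?_
  exact (le_abs_self _).trans_lt (by simpa only [dist_comm, Real.dist_eq, sub_zero] using hlt x hx)

theorem tendstoUniformlyOn_zero_of_le_geometric {X : Type*} {s : Set X} {f : ℕ → X → ℝ} {C q : ℝ}
    (hq : 0 ≤ q) (hq' : q < 1) (h₀ : ∀ n, ∀ x ∈ s, 0 ≤ f n x)
    (h : ∀ n, ∀ x ∈ s, f n x ≤ C * q ^ n) : TendstoUniformlyOn f (fun _ => 0) atTop s := by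
  have hlim : Tendsto (fun n => C * q ^ n) atTop (𝓝 0) := by
    simpa only [mul_zero] using (tendsto_pow_atTop_nhds_zero_of_lt_one hq hq').const_mul C
  rw [Metric.tendstoUniformlyOn_iff]
  intro ε hε
  filter_upwards [hlim.eventually_lt_const hε] with n hn x hx
  rw [dist_comm, Real.dist_eq, sub_zero, abs_of_nonneg (h₀ n x hx)]
  exact (h n x hx).trans_lt hn

theorem eqOn_of_tendstoUniformlyOn_const {X : Type*} {s : Set X} {f g : X → ℝ}
    (h : TendstoUniformlyOn (fun _ : ℕ => f) g atTop s) : EqOn f g s := fun _ hx =>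
  tendsto_nhds_unique tendsto_const_nhds (h.tendsto_at hx)

section IsIteration

variable {L a b c M N : ℝ} {p u w : ℝ → ℝ} {y : ℕ → ℝ → ℝ}

theorem IsIteration.tail (hy : IsIteration L a b c M N p u y) :
    IsIteration L a b c M N p (y 1) fun n => y (n + 1) :=
  ⟨rfl, fun n => hy.2 (n + 1)⟩

theorem IsIteration.isStep_zero (hy : IsIteration L a b c M N p u y) :
    IsStep L a b c M N p u (y 1) :=
  hy.1 ▸ hy.2 0

theorem isIteration_const (hw : IsSolution L a b c p w) :
    IsIteration L a b c M N p w fun _ => w :=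
  ⟨rfl, fun _ => isStep_self_of_isSolution hw⟩

end IsIteration

namespace Admissible

variable {L a b c M N : ℝ} {p α β u v w : ℝ → ℝ} {y z A B : ℕ → ℝ → ℝ}

theorem exists_iteration (S : Admissible L a b c M N p α β) (hu : u ∈ orderInterval L α β) :
    ∃ y, IsIteration L a b c M N p u y := by
  choose T hT using fun y : orderInterval L α β => S.exists_step y.2
  let Y : ℕ → orderInterval L α β :=
    Nat.rec ⟨u, hu⟩ fun _ y => ⟨T y, S.step_mem y.2 (hT y)⟩
  exact ⟨fun n => (Y n).1, rfl, fun n => hT (Y n)⟩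

theorem iteration_eqOn (S : Admissible L a b c M N p α β) (hy : IsIteration L a b c M N p u y)
    (hz : IsIteration L a b c M N p u z) (n : ℕ) : EqOn (z n) (y n) (Icc 0 L) := by
  induction n with
  | zero => rw [hy.1, hz.1]; exact eqOn_refl _ _
  | succ n ih => exact IsStep.eqOn S.hL S.hM S.hN S.hNM ih (hz.2 n) (hy.2 n)

theorem iteration_mem (S : Admissible L a b c M N p α β) (hu : u ∈ orderInterval L α β)
    (hy : IsIteration L a b c M N p u y) (n : ℕ) : y n ∈ orderInterval L α β := by
  induction n with
  | zero => exact hy.1 ▸ hu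
  | succ n ih => exact S.step_mem ih (hy.2 n)

theorem iteration_mono (S : Admissible L a b c M N p α β) (hu : u ∈ orderInterval L α β)
    (hv : v ∈ orderInterval L α β) (huv : Precedes L u v) (hy : IsIteration L a b c M N p u y)
    (hz : IsIteration L a b c M N p v z) (n : ℕ) : Precedes L (y n) (z n) := by
  induction n with
  | zero => rwa [hy.1, hz.1]
  | succ n ih =>
    exact S.step_mono (S.iteration_mem hu hy n) (S.iteration_mem hv hz n) ih (hy.2 n) (hz.2 n)

theorem lower_iteration_mono (S : Admissible L a b c M N p α β)
    (hA : IsIteration L a b c M N p α A) (n : ℕ) : Precedes L (A n) (A (n + 1)) :=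
  S.iteration_mono S.lower_mem (S.iteration_mem S.lower_mem hA 1)
    (S.lower_precedes_step hA.isStep_zero) hA hA.tail n

theorem upper_iteration_mono (S : Admissible L a b c M N p α β)
    (hB : IsIteration L a b c M N p β B) (n : ℕ) : Precedes L (B (n + 1)) (B n) :=
  S.iteration_mono (S.iteration_mem S.upper_mem hB 1) S.upper_mem
    (S.step_precedes_upper hB.isStep_zero) hB.tail hB n

theorem lower_iteration_precedes (S : Admissible L a b c M N p α β)
    (hA : IsIteration L a b c M N p α A) (hu : u ∈ orderInterval L α β)
    (hy : IsIteration L a b c M N p u y) (n : ℕ) : Precedes L (A n) (y n) :=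
  S.iteration_mono S.lower_mem hu (mem_orderInterval_iff.1 hu).2.1 hA hy n

theorem precedes_upper_iteration (S : Admissible L a b c M N p α β)
    (hB : IsIteration L a b c M N p β B) (hu : u ∈ orderInterval L α β)
    (hy : IsIteration L a b c M N p u y) (n : ℕ) : Precedes L (y n) (B n) :=
  S.iteration_mono hu S.upper_mem (mem_orderInterval_iff.1 hu).2.2 hy hB n

theorem iteration_contr (S : Admissible L a b c M N p α β) {δ : ℝ} (hδ : 0 ≤ δ)
    (hu : u ∈ orderInterval L α β) (hv : v ∈ orderInterval L α β) (huv : Precedes L u v)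
    (hy : IsIteration L a b c M N p u y) (hz : IsIteration L a b c M N p v z)
    (h : ∀ x ∈ Icc 0 L, D L 2 u x - D L 2 v x ≤ δ) (n : ℕ) :
    ∀ x ∈ Icc 0 L, D L 2 (y n) x - D L 2 (z n) x ≤ δ * contractionRate L a b c M N α ^ n := by
  induction n with
  | zero => simpa only [hy.1, hz.1, pow_zero, mul_one] using h
  | succ n ih =>
    have hq := S.rate_nonneg
    intro x hx
    rw [pow_succ', mul_left_comm]
    exact S.step_contr (by positivity) (S.iteration_mem hu hy n) (S.iteration_mem hv hz n)
      (S.iteration_mono hu hv huv hy hz n) (hy.2 n) (hz.2 n) ih x hx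

theorem exists_D_two_sub_le (S : Admissible L a b c M N p α β) :
    ∃ δ, 0 ≤ δ ∧ ∀ x ∈ Icc 0 L, D L 2 α x - D L 2 β x ≤ δ := by
  obtain ⟨δ, hδ⟩ := isCompact_Icc.exists_bound_of_continuousOn
    ((continuousOn_D_two S.hL S.lower_mem.1).sub (continuousOn_D_two S.hL S.upper_mem.1))
  exact ⟨δ, (norm_nonneg _).trans (hδ 0 (left_mem_Icc.2 S.hL.le)),
    fun x hx => (le_abs_self _).trans (hδ x hx)⟩

theorem tendstoUniformlyOn_D_two_sub (S : Admissible L a b c M N p α β)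
    (hA : IsIteration L a b c M N p α A) (hB : IsIteration L a b c M N p β B) :
    TendstoUniformlyOn (fun n x => D L 2 (A n) x - D L 2 (B n) x) (fun _ => 0) atTop (Icc 0 L) := by
  obtain ⟨δ, hδ, hle⟩ := S.exists_D_two_sub_le
  exact tendstoUniformlyOn_zero_of_le_geometric S.rate_nonneg S.rate_lt_one
    (fun n x hx => sub_nonneg.2 (S.lower_iteration_precedes hA S.upper_mem hB n x hx).2)
    (S.iteration_contr hδ S.lower_mem S.upper_mem S.precedes hA hB hle)

theorem tendstoUniformlyOn_sub (S : Admissible L a b c M N p α β)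
    (hA : IsIteration L a b c M N p α A) (hB : IsIteration L a b c M N p β B) :
    TendstoUniformlyOn (fun n x => B n x - A n x) (fun _ => 0) atTop (Icc 0 L) := by
  obtain ⟨δ, hδ, hle⟩ := S.exists_D_two_sub_le
  have hq := S.rate_nonneg
  refine tendstoUniformlyOn_zero_of_le_geometric (C := δ * (L ^ 2 / 8)) hq S.rate_lt_one
    (fun n x hx => sub_nonneg.2 (S.lower_iteration_precedes hA S.upper_mem hB n x hx).1)
    fun n x hx => ?_
  rw [mul_right_comm]
  exact S.sub_le_of_D_two_sub_le (S.iteration_mem S.lower_mem hA n)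
    (S.iteration_mem S.upper_mem hB n) (by positivity)
    (S.iteration_contr hδ S.lower_mem S.upper_mem S.precedes hA hB hle n) x hx

theorem tendstoUniformlyOn_of_precedes (S : Admissible L a b c M N p α β)
    (hA : IsIteration L a b c M N p α A) (hB : IsIteration L a b c M N p β B)
    (hy : ∀ n, Precedes L (A n) (y n) ∧ Precedes L (y n) (B n))
    (hw : ∀ n, Precedes L (A n) w ∧ Precedes L w (B n)) :
    TendstoUniformlyOn y w atTop (Icc 0 L) :=
  tendstoUniformlyOn_of_mem_Icc (S.tendstoUniformlyOn_sub hA hB)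
    (fun n x hx => ⟨((hy n).1 x hx).1, ((hy n).2 x hx).1⟩)
    (fun n x hx => ⟨((hw n).1 x hx).1, ((hw n).2 x hx).1⟩)

theorem tendstoUniformlyOn_solution (S : Admissible L a b c M N p α β)
    (hw : IsSolution L a b c p w) (hw' : w ∈ orderInterval L α β) (hu : u ∈ orderInterval L α β)
    (hy : IsIteration L a b c M N p u y) : TendstoUniformlyOn y w atTop (Icc 0 L) := by
  obtain ⟨A, hA⟩ := S.exists_iteration S.lower_mem
  obtain ⟨B, hB⟩ := S.exists_iteration S.upper_mem
  exact S.tendstoUniformlyOn_of_precedes hA hB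
    (fun n => ⟨S.lower_iteration_precedes hA hu hy n, S.precedes_upper_iteration hB hu hy n⟩)
    (fun n => ⟨S.lower_iteration_precedes hA hw' (isIteration_const hw) n,
      S.precedes_upper_iteration hB hw' (isIteration_const hw) n⟩)

theorem solution_eqOn (S : Admissible L a b c M N p α β) (hv : IsSolution L a b c p v)
    (hv' : v ∈ orderInterval L α β) (hw : IsSolution L a b c p w)
    (hw' : w ∈ orderInterval L α β) : EqOn v w (Icc 0 L) :=
  eqOn_of_tendstoUniformlyOn_const
    (S.tendstoUniformlyOn_solution hw hw' hv' (isIteration_const hv))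

theorem D_two_upper_le_D_two_lower (S : Admissible L a b c M N p α β)
    (hA : IsIteration L a b c M N p α A) (hB : IsIteration L a b c M N p β B) {x : ℝ}
    (hx : x ∈ Icc 0 L) (m n : ℕ) : D L 2 (B m) x ≤ D L 2 (A n) x := by
  have hAanti : Antitone fun n => D L 2 (A n) x :=
    antitone_nat_of_succ_le fun n => (S.lower_iteration_mono hA n x hx).2
  have hBmono : Monotone fun n => D L 2 (B n) x :=
    monotone_nat_of_le_succ fun n => (S.upper_iteration_mono hB n x hx).2
  calc D L 2 (B m) x ≤ D L 2 (B (max m n)) x := hBmono (le_max_left m n)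
    _ ≤ D L 2 (A (max m n)) x := (S.lower_iteration_precedes hA S.upper_mem hB (max m n) x hx).2
    _ ≤ D L 2 (A n) x := hAanti (le_max_right m n)

theorem exists_forall_precedes (S : Admissible L a b c M N p α β)
    (hA : IsIteration L a b c M N p α A) (hB : IsIteration L a b c M N p β B) :
    ∃ w, ContDiffOn ℝ 2 w (Icc 0 L) ∧ ∀ n, Precedes L (A n) w ∧ Precedes L w (B n) := by
  have hBA := fun x hx => S.D_two_upper_le_D_two_lower (x := x) hA hB hx
  set ω : ℝ → ℝ := fun x => ⨅ n, D L 2 (A n) x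
  have hωA : ∀ n, ∀ x ∈ Icc 0 L, ω x ≤ D L 2 (A n) x := fun n x hx =>
    ciInf_le ⟨D L 2 (B 0) x, forall_mem_range.2 (hBA x hx 0)⟩ n
  have hBω : ∀ n, ∀ x ∈ Icc 0 L, D L 2 (B n) x ≤ ω x := fun n x hx => le_ciInf (hBA x hx n)
  have hlim : TendstoUniformlyOn (fun n => D L 2 (A n)) ω atTop (Icc 0 L) :=
    tendstoUniformlyOn_of_mem_Icc (S.tendstoUniformlyOn_D_two_sub hA hB)
      (fun n x hx => ⟨hBA x hx n n, le_rfl⟩) fun n x hx => ⟨hBω n x hx, hωA n x hx⟩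
  have hAmem := S.iteration_mem S.lower_mem hA
  have hBmem := S.iteration_mem S.upper_mem hB
  have hωcont : ContinuousOn ω (Icc 0 L) :=
    hlim.continuousOn (.of_forall fun n => continuousOn_D_two S.hL (hAmem n).1)
  obtain ⟨w, hwC, hD₂, hw₀, hw₁⟩ := exists_contDiffOn_D_two_eqOn S.hL hωcont
  have hw := dirichletJet_of_contDiffOn S.hL hwC hw₀ hw₁
  exact ⟨w, hwC, fun n =>
    ⟨precedes_of_D_two_le (S.dirichletJet (hAmem n)) hw fun x hx => hD₂ hx ▸ hωA n x hx,
      precedes_of_D_two_le hw (S.dirichletJet (hBmem n)) fun x hx => hD₂ hx ▸ hBω n x hx⟩⟩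

theorem exists_solution (S : Admissible L a b c M N p α β) :
    ∃ w, IsSolution L a b c p w ∧ w ∈ orderInterval L α β := by
  obtain ⟨A, hA⟩ := S.exists_iteration S.lower_mem
  obtain ⟨B, hB⟩ := S.exists_iteration S.upper_mem
  obtain ⟨w, hwC, hw⟩ := S.exists_forall_precedes hA hB
  have hwmem : w ∈ orderInterval L α β :=
    mem_orderInterval_iff.2 ⟨hwC, hA.1 ▸ (hw 0).1, hB.1 ▸ (hw 0).2⟩
  obtain ⟨w', hw'⟩ := S.exists_step hwmem
  have hw'mem := S.step_mem hwmem hw'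
  have hencl : ∀ n, Precedes L (A n) w' ∧ Precedes L w' (B n) := by
    rintro (_ | n)
    · rw [hA.1, hB.1]
      exact (mem_orderInterval_iff.1 hw'mem).2
    · exact ⟨S.step_mono (S.iteration_mem S.lower_mem hA n) hwmem (hw n).1 (hA.2 n) hw',
        S.step_mono hwmem (S.iteration_mem S.upper_mem hB n) (hw n).2 hw' (hB.2 n)⟩
  have hfix : EqOn w w' (Icc 0 L) :=
    eqOn_of_tendstoUniformlyOn_const (S.tendstoUniformlyOn_of_precedes hA hB hw hencl)
  exact ⟨w', isSolution_of_isStep_of_eqOn S.hL hw' hfix, hw'mem⟩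

end Admissible

end Melan

theorem theorem4p2_general (L a b c M N : ℝ) (p α β : ℝ → ℝ)
    (hL : 0 < L) (hb : 0 ≤ b) (hM : 0 < M) (hN : 0 ≤ N)
    (hp : IntervalIntegrable p volume 0 L)
    (hNM : N ≤ 4 * M / L ^ 3 * Melan.sigma (Real.sqrt M * L))
    (hα : Melan.IsLowerSolution L a b c p α)
    (hβ : Melan.IsUpperSolution L a b c p β)
    (hαβ'' : ∀ x ∈ Icc 0 L, Melan.D L 2 α x ≤ 0 ∧ Melan.D L 2 β x ≤ Melan.D L 2 α x)
    (hβM : a + b * (∫ x in (0 : ℝ)..L, β x) ≤ M)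
    (hβN : c - b * sInf (Melan.D L 2 β '' Icc 0 L) ≤ N)
    (hrate : Melan.contractionRate L a b c M N α < 1) :
    (∀ y₀ ∈ Melan.orderInterval L α β, ∃ y, Melan.IsIteration L a b c M N p y₀ y ∧
      ∀ z, Melan.IsIteration L a b c M N p y₀ z → ∀ n, EqOn (z n) (y n) (Icc 0 L)) ∧
    (∀ A B : ℕ → ℝ → ℝ, Melan.IsIteration L a b c M N p α A →
      Melan.IsIteration L a b c M N p β B → ∀ n, ∀ x ∈ Icc 0 L,
        (A n x ≤ A (n + 1) x ∧ A n x ≤ B n x ∧ B (n + 1) x ≤ B n x) ∧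
        (Melan.D L 2 (A (n + 1)) x ≤ Melan.D L 2 (A n) x ∧
          Melan.D L 2 (B n) x ≤ Melan.D L 2 (A n) x ∧
          Melan.D L 2 (B n) x ≤ Melan.D L 2 (B (n + 1)) x)) ∧
    ∃ w, (Melan.IsSolution L a b c p w ∧ w ∈ Melan.orderInterval L α β) ∧
      (∀ v, Melan.IsSolution L a b c p v → v ∈ Melan.orderInterval L α β →
        EqOn v w (Icc 0 L)) ∧
      (∀ A, Melan.IsIteration L a b c M N p α A → TendstoUniformlyOn A w atTop (Icc 0 L)) ∧
      (∀ B, Melan.IsIteration L a b c M N p β B → TendstoUniformlyOn B w atTop (Icc 0 L)) ∧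
      (∀ y₀ ∈ Melan.orderInterval L α β, ∀ y, Melan.IsIteration L a b c M N p y₀ y →
        TendstoUniformlyOn y w atTop (Icc 0 L)) := by
  have S : Melan.Admissible L a b c M N p α β :=
    { hL, hb, hM, hN, hNM, hp, lower := hα, upper := hβ, le_M := hβM, rate_lt_one := hrate
      concave := fun x hx => (hαβ'' x hx).1
      D_two_le := fun x hx => (hαβ'' x hx).2
      le_N := Melan.sub_mul_D_two_le_of_sub_mul_sInf_le hL hb hβ.1.contDiffOn hβN }
  obtain ⟨w, hw, hw'⟩ := S.exists_solution
  refine ⟨fun y₀ hy₀ => ?_, fun A B hA hB n x hx => ?_, w, ⟨hw, hw'⟩,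
    fun v hv hv' => S.solution_eqOn hv hv' hw hw',
    fun A hA => S.tendstoUniformlyOn_solution hw hw' S.lower_mem hA,
    fun B hB => S.tendstoUniformlyOn_solution hw hw' S.upper_mem hB,
    fun y₀ hy₀ y hy => S.tendstoUniformlyOn_solution hw hw' hy₀ hy⟩
  · obtain ⟨y, hy⟩ := S.exists_iteration hy₀
    exact ⟨y, hy, fun z hz => S.iteration_eqOn hy hz⟩
  · obtain ⟨hA₀, hA₂⟩ := S.lower_iteration_mono hA n x hx
    obtain ⟨hAB₀, hAB₂⟩ := S.lower_iteration_precedes hA S.upper_mem hB n x hx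
    obtain ⟨hB₀, hB₂⟩ := S.upper_iteration_mono hB n x hx
    exact ⟨⟨hA₀, hAB₀, hB₀⟩, hA₂, hAB₂, hB₂⟩

theorem theorem4p2 (L a b c M N : ℝ) (p α β : ℝ → ℝ)
    (hL : 0 < L) (ha : 0 < a) (hb : 0 < b) (hc : 0 < c) (hM : 0 < M) (hN : 0 < N)
    (hp : IntervalIntegrable p volume 0 L)
    (hNM : N ≤ 4 * M / L ^ 3 * Melan.sigma (Real.sqrt M * L))
    (hα : Melan.IsLowerSolution L a b c p α)
    (hβ : Melan.IsUpperSolution L a b c p β)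
    (hαβ : ∀ x ∈ Icc 0 L, 0 ≤ α x ∧ α x ≤ β x)
    (hαβ'' : ∀ x ∈ Icc 0 L, Melan.D L 2 α x ≤ 0 ∧ Melan.D L 2 β x ≤ Melan.D L 2 α x)
    (hβM : a + b * (∫ x in (0 : ℝ)..L, β x) ≤ M)
    (hβN : c - b * sInf (Melan.D L 2 β '' Icc 0 L) ≤ N)
    (hcontr : a + b * (∫ x in (0 : ℝ)..L, α x) + L ^ 3 / 4 * c
      > L ^ 3 * N / 4 + M - 4 / L ^ 2) :
    -- the iterative procedure is well defined for every initial function in `[α, β]`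
    (∀ y₀ ∈ Melan.orderInterval L α β, ∃ y, Melan.IsIteration L a b c M N p y₀ y ∧
      ∀ z, Melan.IsIteration L a b c M N p y₀ z → ∀ n, EqOn (z n) (y n) (Icc 0 L)) ∧
    -- the sequences started from `α` and `β` are monotone and ordered, with second derivatives
    (∀ A B : ℕ → ℝ → ℝ, Melan.IsIteration L a b c M N p α A →
      Melan.IsIteration L a b c M N p β B → ∀ n, ∀ x ∈ Icc 0 L,
        (A n x ≤ A (n + 1) x ∧ A n x ≤ B n x ∧ B (n + 1) x ≤ B n x) ∧
        (Melan.D L 2 (A (n + 1)) x ≤ Melan.D L 2 (A n) x ∧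
          Melan.D L 2 (B n) x ≤ Melan.D L 2 (A n) x ∧
          Melan.D L 2 (B n) x ≤ Melan.D L 2 (B (n + 1)) x)) ∧
    -- there is exactly one solution in `[α, β]`, and all iterations converge to it uniformly
    ∃ w, (Melan.IsSolution L a b c p w ∧ w ∈ Melan.orderInterval L α β) ∧
      (∀ v, Melan.IsSolution L a b c p v → v ∈ Melan.orderInterval L α β →
        EqOn v w (Icc 0 L)) ∧
      (∀ A, Melan.IsIteration L a b c M N p α A → TendstoUniformlyOn A w atTop (Icc 0 L)) ∧
      (∀ B, Melan.IsIteration L a b c M N p β B → TendstoUniformlyOn B w atTop (Icc 0 L)) ∧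
      (∀ y₀ ∈ Melan.orderInterval L α β, ∀ y, Melan.IsIteration L a b c M N p y₀ y →
        TendstoUniformlyOn y w atTop (Icc 0 L)) := by
  have hcN : c ≤ N := hβ.2.1.le_of_sub_mul_D_two_le hL.le
    (Melan.sub_mul_D_two_le_of_sub_mul_sInf_le hL hb.le hβ.1.contDiffOn hβN)
  exact theorem4p2_general L a b c M N p α β hL hb.le hM hN.le hp hNM hα hβ hαβ'' hβM hβN
    (Melan.contractionRate_lt_one hL hcN hcontr)
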